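/- **Setting.** Let $X\subseteq\mathbb R^d$ be closed, $\rho$ a Borel probability measure on $X\times\mathbb R$ with marginal $\rho_X$ on $X$ and $\int y^2\,d\rho<\infty$. Write $\mathcal L^2_\rho=L^2(X,\rho_X)$ with norm $\|\cdot\|_\rho$, $\mathcal E(f)=\int (f(x)-y)^2\,d\rho(x,y)$, and $f_\rho(x)=\int y\,d\rho(y|x)$. Let $\mu$ be a probability measure on a measurable space $V$, and $\phi:V\times X\to\mathbb R$, $\phi_v(x)=\phi(v,x)$, a measurable function that is square-integrable with respect to $\mu\otimes\rho_X$, with $\phi(\cdot,x)\in L^2_\mu$ for all $x\in X$. Let $K(x,x')=\int_V\phi_v(x)\phi_v(x')\,d\mu(v)$ for $x,x'\in X$, and let $L_Kf=\int_X f(x)K(x,\cdot)\,d\rho_X(x)$ be the associated integral operator on $\mathcal L^2_\rho$. Assume: 1. (boundedness) $K$ is measurable and for some $\kappa\ge 1$, almost surely $K(x,x)\le\kappa^2$ and $\phi_v(x)\phi_v(x')\le\kappa^2$ (for $v\sim\mu$ and $x,x'\sim\rho_X$ independent); 2. (regularity) for some $\zeta>0$, $R>0$: $\|L_K^{-\zeta}f_\rho\|_\rho\le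 R$, i.e. $f_\rho=L_K^{\zeta}g$ for some $g\in\mathcal L^2_\rho$ with $\|g\|_\rho\le R$; 3. (capacity) for some $\gamma\in[0,1]$, $c_\gamma>0$: $\operatorname{tr}(L_K(L_K+\lambda I)^{-1})\le c_\gamma\lambda^{-\gamma}$ for all $\lambda>0$. Let $T\in\mathbb N$, let $z_k=(x_k,y_k)$, $k=1,\dots,T$, be i.i.d. from $\rho$, and let $v_1,\dots,v_T$ be i.i.d. from $\mu$, independent of the $z_k$. For step sizes $\eta_t>0$ the (unregularized, $\lambda=0$) doubly stochastic learning algorithm is $$f_1=0,\qquad f_{t+1}=f_t-\eta_t\,(f_t(x_t)-y_t)\,\phi_{v_t}(x_t)\,\phi_{v_t},\qquad t=1,\dots,T.$$ **Statement.** Let $\gamma\neq1$ and $\eta_t=\eta_1t^{-\theta}$ for $t\in\{1,\dots,T\}$. There is a constant $C>0$, depending only on $\kappa,c_\gamma,\gamma,\zeta,R$ and on (upper bounds for) $\|f_\rho\|_\rho$ and $\mathcal E(f_\rho)$ (in particular not on $t$ or $T$), such that for every $t$ with $2\le t\le T$: a) if $2\zeta<1-\gamma$, $\theta=\frac{2\zeta+\gamma}{2\zeta+\gamma+1}$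 and $\eta_1=\frac{\zeta}{3\kappa^2(2c_\gamma+\kappa^2)}$, then $$\mathbb E\big[\|f_{t+1}-f_\rho\|_\rho^2\big]\le C\,t^{-\frac{2\zeta}{2\zeta+\gamma+1}}\ln t;$$ b) if $2\zeta\ge1-\gamma$, $\theta=\frac12$ and $\eta_1=\frac{1-\gamma}{6\kappa^2(2c_\gamma+\kappa^2)}$, then $$\mathbb E\big[\|f_{t+1}-f_\rho\|_\rho^2\big]\le C\,t^{\frac{\gamma-1}{2}}\ln t.$$ -/

import Mathlib

open MeasureTheory ProbabilityTheory
open scoped ENNReal InnerProductSpace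

namespace DoublyStochastic

noncomputable section

/-! ### Operators on a real Hilbert space -/

section Operators

variable {H : Type*} [NormedAddCommGroup H] [InnerProductSpace ℝ H] [CompleteSpace H]

/-- The trace `∑ᵢ ⟪eᵢ, A eᵢ⟫ ∈ [0, ∞]` of a positive operator `A`, computed in a Hilbert basis
`(eᵢ)` of `H`; for positive `A` it does not depend on the basis. -/
def posTrace (A : H →L[ℝ] H) : ℝ≥0∞ :=
  ∑' e : (exists_hilbertBasis ℝ H).choose, ENNReal.ofReal ⟪(e : H), A e⟫_ℝ

/-- The trace of a positive diagonalizable operator is the sum of its eigenvalues. -/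
theorem posTrace_eq_tsum_eigenvalues (A : H →L[ℝ] H) {ι : Type*} (b : HilbertBasis ι ℝ H)
    (σ : ι → ℝ) (hσ : ∀ i, 0 ≤ σ i) (hA : ∀ i, A (b i) = σ i • b i) :
    posTrace A = ∑' i, ENNReal.ofReal (σ i) := by
  obtain ⟨c, hc⟩ := (exists_hilbertBasis ℝ H).choose_spec
  have key : ∀ x : H, ENNReal.ofReal ⟪x, A x⟫_ℝ
      = ∑' i, ENNReal.ofReal (σ i) * ENNReal.ofReal (⟪x, b i⟫_ℝ ^ 2) := by
    intro x
    have h1 : HasSum (fun i => σ i * ⟪x, b i⟫_ℝ ^ 2) ⟪x, A x⟫_ℝ := by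
      have h2 := (b.hasSum_repr x).mapL ((innerSL ℝ x).comp A)
      have h5 : (fun i => σ i * ⟪x, b i⟫_ℝ ^ 2)
          = fun i => ((innerSL ℝ x).comp A) (b.repr x i • b i) := by
        funext i
        rw [map_smul, ContinuousLinearMap.comp_apply, hA, innerSL_apply_apply,
          real_inner_smul_right, b.repr_apply_apply, real_inner_comm, smul_eq_mul]
        ring
      rw [h5]
      exact h2
    rw [← h1.tsum_eq, ENNReal.ofReal_tsum_of_nonneg
      (fun i => mul_nonneg (hσ i) (sq_nonneg _)) h1.summable]
    exact tsum_congr fun i => ENNReal.ofReal_mul (hσ i)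
  have hsq : ∀ y : H, ‖y‖ = 1 →
      ∑' e : (exists_hilbertBasis ℝ H).choose, ENNReal.ofReal (⟪(e : H), y⟫_ℝ ^ 2) = 1 := by
    intro y hy
    have h3 : HasSum (fun e : (exists_hilbertBasis ℝ H).choose => ⟪(e : H), y⟫_ℝ ^ 2) 1 := by
      have h4 := c.hasSum_inner_mul_inner y y
      rw [real_inner_self_eq_norm_sq, hy, one_pow] at h4
      have h5 : (fun e : (exists_hilbertBasis ℝ H).choose => ⟪(e : H), y⟫_ℝ ^ 2)
          = fun e => ⟪y, c e⟫_ℝ * ⟪c e, y⟫_ℝ := by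
        funext e
        rw [hc, real_inner_comm y, sq]
      rw [h5]
      exact h4
    rw [← ENNReal.ofReal_tsum_of_nonneg (fun _ => sq_nonneg _) h3.summable, h3.tsum_eq,
      ENNReal.ofReal_one]
  calc posTrace A
      = ∑' (e : (exists_hilbertBasis ℝ H).choose) (i : ι),
          ENNReal.ofReal (σ i) * ENNReal.ofReal (⟪(e : H), b i⟫_ℝ ^ 2) :=
        tsum_congr fun e => key e
    _ = ∑' (i : ι) (e : (exists_hilbertBasis ℝ H).choose),
          ENNReal.ofReal (σ i) * ENNReal.ofReal (⟪(e : H), b i⟫_ℝ ^ 2) := ENNReal.tsum_comm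
    _ = ∑' i, ENNReal.ofReal (σ i) := by
        refine tsum_congr fun i => ?_
        rw [ENNReal.tsum_mul_left, hsq _ (b.orthonormal.1 i), mul_one]

/-- The power `A ^ s`, `s > 0`, of a positive compact operator `A`, applied to a vector `g`:
`∑_σ σ ^ s P_σ g`, where `P_σ` is the orthogonal projection onto the eigenspace
`{x | A x = σ x}` (the terms in which `σ` is not an eigenvalue vanish). -/
def opRpow (A : H →L[ℝ] H) (s : ℝ) (g : H) : H :=
  ∑' σ : ℝ, σ ^ s • (A - σ • ContinuousLinearMap.id ℝ H).ker.starProjection g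

/-- On an eigenvector with eigenvalue `σ`, the power `A ^ s` acts as multiplication by `σ ^ s`. -/
theorem opRpow_eigenvector (A : H →L[ℝ] H) (hA : (A : H →ₗ[ℝ] H).IsSymmetric) (s σ : ℝ) (x : H)
    (hx : A x = σ • x) : opRpow A s x = σ ^ s • x := by
  unfold opRpow
  rw [tsum_eq_single σ]
  · rw [Submodule.starProjection_eq_self_iff.mpr]
    simp [LinearMap.mem_ker, hx]
  · intro τ hτ
    rw [(Submodule.starProjection_apply_eq_zero_iff _).mpr, smul_zero]
    rw [Submodule.mem_orthogonal]
    intro u hu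
    have hu' : A u = τ • u := by simpa [sub_eq_zero] using hu
    have h := hA u x
    simp only [ContinuousLinearMap.coe_coe] at h
    rw [hu', hx, real_inner_smul_left, real_inner_smul_right] at h
    have : (τ - σ) * ⟪u, x⟫_ℝ = 0 := by linarith
    exact (mul_eq_zero.mp this).resolve_left (sub_ne_zero.mpr hτ)

end Operators

/-! ### Integral operators -/

section IntegralOperator

variable {𝒳 : Type*} [MeasurableSpace 𝒳]

theorem exists_integralOperator (ν : Measure 𝒳) [IsFiniteMeasure ν] (K : 𝒳 → 𝒳 → ℝ)
    (hK : MemLp (Function.uncurry K) 2 (ν.prod ν)) :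
    ∃ L : Lp ℝ 2 ν →L[ℝ] Lp ℝ 2 ν, ∀ f : Lp ℝ 2 ν,
      (L f : 𝒳 → ℝ) =ᵐ[ν] fun x' => ∫ x, f x * K x x' ∂ν := by
  have hsec : ∀ᵐ x' ∂ν, MemLp (fun x => K x x') 2 ν := by
    have h1 : Integrable (fun p : 𝒳 × 𝒳 => K p.1 p.2 ^ 2) (ν.prod ν) := hK.integrable_sq
    have h2 := h1.prod_left_ae
    have h3 : ∀ᵐ x' ∂ν, AEStronglyMeasurable (fun x => K x x') ν := by
      have := hK.aestronglyMeasurable.prodMk_left (μ := ν) (ν := ν)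
      have h4 := (hK.aestronglyMeasurable.prod_swap).prodMk_left
      exact h4
    filter_upwards [h2, h3] with x' a b
    exact (memLp_two_iff_integrable_sq b).mpr a
  have hint : ∀ f : Lp ℝ 2 ν, ∀ᵐ x' ∂ν, Integrable (fun x => f x * K x x') ν := by
    intro f
    filter_upwards [hsec] with x' h
    exact (Lp.memLp f).integrable_mul h
  set N : 𝒳 → ℝ := fun x' => ∫ x, K x x' ^ 2 ∂ν with hN
  have hNint : Integrable N ν := (hK.integrable_sq : Integrable _ (ν.prod ν)).integral_prod_right
  have hN0 : ∀ x', 0 ≤ N x' := fun x' => integral_nonneg fun _ => sq_nonneg _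
  have hbd : ∀ f : Lp ℝ 2 ν, ∀ᵐ x' ∂ν, (∫ x, f x * K x x' ∂ν) ^ 2 ≤ ‖f‖ ^ 2 * N x' := by
    intro f
    filter_upwards [hsec] with x' h
    have h1 : ∫ x, f x * K x x' ∂ν = ⟪h.toLp _, f⟫_ℝ := by
      rw [L2.inner_def]
      refine integral_congr_ae ?_
      filter_upwards [h.coeFn_toLp] with x hx
      simp [hx]
    have h2 : ‖h.toLp _‖ ^ 2 = N x' := by
      rw [← real_inner_self_eq_norm_sq, L2.inner_def]
      refine integral_congr_ae ?_
      filter_upwards [h.coeFn_toLp] with x hx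
      simp [hx]
    rw [h1, ← h2]
    have := abs_real_inner_le_norm (h.toLp _) f
    rw [← sq_abs, ← mul_pow, mul_comm ‖f‖]
    gcongr
  have hmeas : ∀ f : Lp ℝ 2 ν, AEStronglyMeasurable (fun x' => ∫ x, f x * K x x' ∂ν) ν := by
    intro f
    have h1 : AEStronglyMeasurable (fun p : 𝒳 × 𝒳 => f p.2 * K p.2 p.1) (ν.prod ν) :=
      ((Lp.memLp f).aestronglyMeasurable.comp_snd).mul hK.aestronglyMeasurable.prod_swap
    exact h1.integral_prod_right'
  have hmem : ∀ f : Lp ℝ 2 ν, MemLp (fun x' => ∫ x, f x * K x x' ∂ν) 2 ν := by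
    intro f
    rw [memLp_two_iff_integrable_sq (hmeas f)]
    refine (hNint.const_mul (‖f‖ ^ 2)).mono' ((hmeas f).pow 2) ?_
    filter_upwards [hbd f] with x' h
    rwa [Real.norm_of_nonneg (sq_nonneg _)]
  let L₀ : Lp ℝ 2 ν →ₗ[ℝ] Lp ℝ 2 ν :=
    { toFun := fun f => (hmem f).toLp _
      map_add' := by
        intro f g
        rw [← MemLp.toLp_add]
        refine MemLp.toLp_congr _ _ ?_
        filter_upwards [hint f, hint g] with x' hf hg
        simp only [Pi.add_apply]
        rw [← integral_add hf hg]
        refine integral_congr_ae ?_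
        filter_upwards [Lp.coeFn_add f g] with x hx
        rw [hx, Pi.add_apply, add_mul]
      map_smul' := by
        intro a f
        rw [RingHom.id_apply, ← MemLp.toLp_const_smul]
        refine MemLp.toLp_congr _ _ ?_
        filter_upwards with x'
        simp only [Pi.smul_apply, smul_eq_mul]
        rw [← integral_const_mul]
        refine integral_congr_ae ?_
        filter_upwards [Lp.coeFn_smul a f] with x hx
        rw [hx, Pi.smul_apply, smul_eq_mul, mul_assoc] }
  refine ⟨L₀.mkContinuous (Real.sqrt (∫ x', N x' ∂ν)) ?_, fun f => (hmem f).coeFn_toLp⟩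
  intro f
  have h0 : 0 ≤ ∫ x', N x' ∂ν := integral_nonneg hN0
  refine abs_le_of_sq_le_sq' ?_ (by positivity) |>.2
  rw [mul_pow, Real.sq_sqrt h0]
  change ‖(hmem f).toLp _‖ ^ 2 ≤ _
  rw [← real_inner_self_eq_norm_sq, L2.inner_def, mul_comm, ← integral_const_mul]
  have h5 : ∀ᵐ x' ∂ν, ⟪((hmem f).toLp _ : Lp ℝ 2 ν) x', ((hmem f).toLp _ : Lp ℝ 2 ν) x'⟫_ℝ
      = (∫ x, f x * K x x' ∂ν) ^ 2 := by
    filter_upwards [(hmem f).coeFn_toLp] with x' hx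
    rw [hx]; simp [sq]
  rw [integral_congr_ae h5]
  exact integral_mono_ae (hmem f).integrable_sq (hNint.const_mul _) (hbd f)

open Classical in
/-- The integral operator `L_K : L²(ν) → L²(ν)`, `(L_K f)(x') = ∫ f(x) K(x, x') dν(x)`.  It exists
as a bounded operator as soon as `K ∈ L²(ν ⊗ ν)` (`exists_integralOperator`), in particular when
`K` is measurable and bounded. -/
def integralOperator (ν : Measure 𝒳) (K : 𝒳 → 𝒳 → ℝ) : Lp ℝ 2 ν →L[ℝ] Lp ℝ 2 ν :=
  if h : ∃ L : Lp ℝ 2 ν →L[ℝ] Lp ℝ 2 ν, ∀ f : Lp ℝ 2 ν,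
      (L f : 𝒳 → ℝ) =ᵐ[ν] fun x' => ∫ x, f x * K x x' ∂ν
  then h.choose else 0

theorem integralOperator_apply (ν : Measure 𝒳) [IsFiniteMeasure ν] (K : 𝒳 → 𝒳 → ℝ)
    (hK : MemLp (Function.uncurry K) 2 (ν.prod ν)) (f : Lp ℝ 2 ν) :
    (integralOperator ν K f : 𝒳 → ℝ) =ᵐ[ν] fun x' => ∫ x, f x * K x x' ∂ν := by
  have h := exists_integralOperator ν K hK
  rw [integralOperator, dif_pos h]
  exact h.choose_spec f

end IntegralOperator

/-! ### The learning setting -/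

section Learning

variable {𝒳 : Type*} [MeasurableSpace 𝒳] {V : Type*} [MeasurableSpace V]

/-- The expected risk `ℰ(f) = ∫ (f(x) - y)² dρ(x, y)` of the square loss. -/
def expectedRisk (ρ : Measure (𝒳 × ℝ)) (f : 𝒳 → ℝ) : ℝ :=
  ∫ z, (f z.1 - z.2) ^ 2 ∂ρ

/-- The regression function `f_ρ(x) = ∫ y dρ(y | x)`. -/
def regressionFunction (ρ : Measure (𝒳 × ℝ)) [IsFiniteMeasure ρ] (x : 𝒳) : ℝ :=
  ∫ y, y ∂(ρ.condKernel x)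

/-- Standing assumptions: `∫ y² dρ < ∞`, the feature map `φ` is (jointly measurable and)
square-integrable with respect to `μ ⊗ ρ_X`, and `K(x, x') = ⟨φ(·, x), φ(·, x')⟩` in `L²(μ)` for
all `x, x'`.  The marginal `ρ_X` is `ρ.fst`. -/
structure IsFeatureModel (ρ : Measure (𝒳 × ℝ)) (μ : Measure V) (φ : V → 𝒳 → ℝ)
    (K : 𝒳 → 𝒳 → ℝ) : Prop where
  integrable_sq : Integrable (fun z : 𝒳 × ℝ => z.2 ^ 2) ρ
  measurable_feature : Measurable (Function.uncurry φ)
  memLp_feature : MemLp (Function.uncurry φ) 2 (μ.prod ρ.fst)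
  memLp_feature_at : ∀ x, MemLp (fun v => φ v x) 2 μ
  kernel_eq : ∀ x x', K x x' = ∫ v, φ v x * φ v x' ∂μ

/-- Boundedness: `K` is measurable, and almost surely `K(x, x) ≤ κ²` and
`φ_v(x) φ_v(x') ≤ κ²`. -/
structure Bounded (ρ : Measure (𝒳 × ℝ)) (μ : Measure V) (φ : V → 𝒳 → ℝ)
    (K : 𝒳 → 𝒳 → ℝ) (κ : ℝ) : Prop where
  measurable_kernel : Measurable (Function.uncurry K)
  kernel_le : ∀ᵐ x ∂ρ.fst, K x x ≤ κ ^ 2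
  feature_le : ∀ᵐ p ∂(μ.prod (ρ.fst.prod ρ.fst)), φ p.1 p.2.1 * φ p.1 p.2.2 ≤ κ ^ 2

/-- Regularity `‖L_K^{-ζ} f_ρ‖ ≤ R`: `f_ρ = L_K^ζ g` for some `g ∈ L²(ρ_X)` with `‖g‖ ≤ R`. -/
def Regular (ρ : Measure (𝒳 × ℝ)) [IsFiniteMeasure ρ] (K : 𝒳 → 𝒳 → ℝ) (ζ R : ℝ) : Prop :=
  ∃ g : Lp ℝ 2 ρ.fst, ‖g‖ ≤ R ∧
    ((opRpow (integralOperator ρ.fst K) ζ g : Lp ℝ 2 ρ.fst) : 𝒳 → ℝ) =ᵐ[ρ.fst] regressionFunction ρ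

/-- Capacity: `tr (L_K (L_K + λ I)⁻¹) ≤ c λ^{-γ}` for all `λ > 0`. -/
def Capacity (ρ : Measure (𝒳 × ℝ)) (K : 𝒳 → 𝒳 → ℝ) (γ c : ℝ) : Prop :=
  ∀ lam : ℝ, 0 < lam →
    posTrace (integralOperator ρ.fst K *
      Ring.inverse (integralOperator ρ.fst K + lam • (1 : Lp ℝ 2 ρ.fst →L[ℝ] Lp ℝ 2 ρ.fst)))
      ≤ ENNReal.ofReal (c * lam ^ (-γ))

/-- The doubly stochastic learning algorithm with step sizes `η_t`, regularization parameter `lam`,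
features `φ` and data `w t = ((x_t, y_t), v_t)`, `t = 1, 2, …`.  The function
`dsIterate η lam φ w t` is `f_{t+1}`, the function reached after `t` steps:
`f_1 = 0`, `f_{t+1} = (1 - η_t lam) f_t - η_t (f_t(x_t) - y_t) φ_{v_t}(x_t) φ_{v_t}`. -/
def dsIterate (η : ℕ → ℝ) (lam : ℝ) (φ : V → 𝒳 → ℝ) (w : ℕ → (𝒳 × ℝ) × V) : ℕ → 𝒳 → ℝ
  | 0 => fun _ => 0
  | t + 1 => fun x =>
      (1 - η (t + 1) * lam) * dsIterate η lam φ w t x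
        - η (t + 1) * (dsIterate η lam φ w t (w (t + 1)).1.1 - (w (t + 1)).1.2)
          * φ (w (t + 1)).2 (w (t + 1)).1.1 * φ (w (t + 1)).2 x

variable {Ω : Type*} [MeasurableSpace Ω]

/-- The pairs `(z_k, v_k)`, `1 ≤ k ≤ T`, are independent with common law `ρ ⊗ μ`; that is,
`z_1, …, z_T` are i.i.d. from `ρ`, and `v_1, …, v_T` are i.i.d. from `μ` and independent of them. -/
def IsSample (P : Measure Ω) (ρ : Measure (𝒳 × ℝ)) (μ : Measure V) (T : ℕ)
    (w : ℕ → Ω → (𝒳 × ℝ) × V) : Prop :=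
  iIndepFun (fun k : Set.Icc 1 T => w k) P ∧ ∀ k ∈ Set.Icc 1 T, HasLaw (w k) (ρ.prod μ) P

/-- The expected excess risk `𝔼 ‖f_{t+1} - f_ρ‖²`, with the norm of `L²(ρ_X)`. -/
def expectedExcess (P : Measure Ω) (ρ : Measure (𝒳 × ℝ)) [IsFiniteMeasure ρ] (φ : V → 𝒳 → ℝ)
    (w : ℕ → Ω → (𝒳 × ℝ) × V) (η : ℕ → ℝ) (lam : ℝ) (t : ℕ) : ℝ≥0∞ :=
  ∫⁻ ω, eLpNorm (fun x => dsIterate η lam φ (fun k => w k ω) t x - regressionFunction ρ x)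
    2 ρ.fst ^ 2 ∂P

end Learning

end

end DoublyStochastic

namespace DoublyStochastic

set_option linter.unusedSectionVars false

/-! ### Elementary inequalities -/

/-! The error `f_{t+1} - f_ρ` is followed along each eigenvector of `L_K` separately. The features
are almost surely bounded by `κ`, so `L_K` is positive and Hilbert–Schmidt, and `L²(ρ_X)` has an
orthonormal eigenbasis with eigenvalues `σᵢ ∈ [0, κ²]` (`exists_eigenbasis_integralOperator`). On
average over a fresh sample, a step multiplies the `i`-th coordinate by `1 - ησᵢ`. The noise it adds
to the second moment is at most `κ²η²σᵢ (‖f - f_ρ‖² + ℰ(f_ρ))`, where `f` is the current iterate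
(`lintegral_coordinate_step_le`). The factor `σᵢ` is essential: it makes the noise summable over
`i`.

Unrolling and summing over `i` leaves two terms. The bias is `‖exp(-sL) L^ζ g‖² ≲ s^(-2ζ)`, where
`s`, the sum of the steps, is at least of order `t^(1-θ)`. The variance is a sum over past steps of
`η² tr(L exp(-2s'L))` times the excess risk at that step plus `ℰ(f_ρ)`, with `s'` the sum of the
later steps. Comparing `exp(-2s'L)` with the resolvent at `λ = 1/s'`, the capacity condition bounds
the trace by a multiple of `s'^(γ-1)`, and the total weight of the past becomes `t^(-(θ(1+γ)-γ)) (1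
+ log t)` up to a constant (`tsum_mul_exp_le`, `sum_weights_le`).

The variance still contains the unknown excess risks. Since the total weight tends to `0`, a
discrete Gronwall argument bounds them by a constant independent of `T`
(`exists_bound_of_weights_tendsto_zero`); inserting that constant once more gives the rate. The
exponents `2ζ(1-θ)` and `θ(1+γ)-γ` are balanced by the `θ` of case a); in case b) `θ` stops at `1/2`
and the variance dominates. -/

theorem rpow_mul_exp_neg_le {a x : ℝ} (ha : 0 < a) (hx : 0 ≤ x) :
    x ^ a * Real.exp (-(2 * x)) ≤ a ^ a := by
  have h1 : x / a ≤ Real.exp (x / a) := by linarith [Real.add_one_le_exp (x / a)]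
  have h2 : x ^ a ≤ a ^ a * Real.exp x := by
    calc x ^ a = (a * (x / a)) ^ a := by rw [mul_div_cancel₀ _ ha.ne']
      _ = a ^ a * (x / a) ^ a := Real.mul_rpow ha.le (by positivity)
      _ ≤ a ^ a * (Real.exp (x / a)) ^ a := by gcongr
      _ = a ^ a * Real.exp x := by rw [← Real.exp_mul, div_mul_cancel₀ _ ha.ne']
  calc x ^ a * Real.exp (-(2 * x)) ≤ a ^ a * Real.exp x * Real.exp (-(2 * x)) := by gcongr
    _ = a ^ a * Real.exp (-x) := by rw [mul_assoc, ← Real.exp_add]; ring_nf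
    _ ≤ a ^ a * 1 := by
        gcongr
        exact Real.exp_le_one_iff.mpr (by linarith)
    _ = a ^ a := mul_one _

theorem rpow_mul_exp_neg_mul_le {a x s : ℝ} (ha : 0 < a) (hx : 0 ≤ x) (hs : 0 < s) :
    x ^ a * Real.exp (-(2 * (x * s))) ≤ a ^ a * s ^ (-a) := by
  have h := rpow_mul_exp_neg_le ha (mul_nonneg hx hs.le)
  rw [Real.mul_rpow hx hs.le] at h
  have hsa : 0 < s ^ a := Real.rpow_pos_of_pos hs a
  rw [Real.rpow_neg hs.le, ← div_eq_mul_inv, le_div_iff₀ hsa]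
  linarith

/-- Compares the heat-type weight with the resolvent at `λ = 1/q`, the quantity that the capacity
condition controls. It reduces to `(xq + 1) exp(-2xq) ≤ 1`. -/
theorem mul_exp_neg_le_div {x q : ℝ} (hx : 0 ≤ x) (hq : 0 < q) :
    x * Real.exp (-(2 * (x * q))) ≤ x / (x + q⁻¹) * q⁻¹ := by
  have hqi : 0 < q⁻¹ := inv_pos.mpr hq
  have h1 : (x * q + 1) * Real.exp (-(2 * (x * q))) ≤ 1 := by
    have h2 : x * q + 1 ≤ Real.exp (2 * (x * q)) := by
      have := Real.add_one_le_exp (2 * (x * q))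
      nlinarith [mul_nonneg hx hq.le]
    rw [Real.exp_neg, ← div_eq_mul_inv]
    exact (div_le_one (Real.exp_pos _)).mpr h2
  have h3 : (x + q⁻¹) * Real.exp (-(2 * (x * q))) ≤ q⁻¹ := by
    have : (x + q⁻¹) = (x * q + 1) * q⁻¹ := by field_simp
    rw [this, mul_right_comm]
    nlinarith
  rw [div_mul_eq_mul_div, le_div_iff₀ (by positivity), mul_assoc]
  gcongr
  linarith

theorem sum_inv_succ_le (t : ℕ) :
    ∑ k ∈ Finset.range t, ((k : ℝ) + 1)⁻¹ ≤ 1 + Real.log t := by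
  have h := harmonic_le_one_add_log t
  rw [harmonic] at h
  push_cast at h
  exact h

theorem rpow_neg_le_mul_inv {a s t : ℝ} (ha : a ≤ 1) (hs : 0 < s) (hst : s ≤ t) :
    s ^ (-a) ≤ t ^ (1 - a) * s⁻¹ := by
  have : s ^ (-a) = s ^ (1 - a) * s⁻¹ := by
    rw [← Real.rpow_neg_one s, ← Real.rpow_add hs]; ring_nf
  rw [this]
  gcongr

theorem rpow_neg_le_two_mul {a s t : ℝ} (ha0 : 0 ≤ a) (ha : a ≤ 1) (ht : 0 < t)
    (hst : t / 2 ≤ s) : s ^ (-a) ≤ 2 * t ^ (-a) := by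
  calc s ^ (-a) ≤ (t / 2) ^ (-a) :=
        Real.rpow_le_rpow_of_nonpos (by positivity) hst (by linarith)
    _ = t ^ (-a) * 2 ^ a := by
        rw [Real.div_rpow ht.le (by norm_num), Real.rpow_neg (by norm_num : (0 : ℝ) ≤ 2),
          div_inv_eq_mul]
    _ ≤ t ^ (-a) * 2 ^ (1 : ℝ) := by gcongr; norm_num
    _ = 2 * t ^ (-a) := by rw [Real.rpow_one, mul_comm]

/-- Split at `k + 1 = t/2`. In each half one base is at least `t/2`, so that factor is a power of
`t`; the other is traded for an inverse, at the price of a harmonic sum. The logarithm makes the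
bound uniform up to the endpoints `a = 1` and `b = 1`. -/
theorem sum_rpow_mul_rpow_le {a b : ℝ} (ha0 : 0 ≤ a) (ha1 : a ≤ 1) (hb0 : 0 ≤ b) (hb1 : b ≤ 1)
    {t : ℕ} (ht : 1 ≤ t) :
    ∑ k ∈ Finset.range t, ((k : ℝ) + 1) ^ (-a) * ((t : ℝ) - k) ^ (-b)
      ≤ 4 * (t : ℝ) ^ (1 - a - b) * (1 + Real.log t) := by
  have ht0 : (0 : ℝ) < t := by exact_mod_cast ht
  have hpw : ∀ k ∈ Finset.range t, ((k : ℝ) + 1) ^ (-a) * ((t : ℝ) - k) ^ (-b)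
      ≤ 2 * (t : ℝ) ^ (1 - a - b) * (((k : ℝ) + 1)⁻¹ + ((t : ℝ) - k)⁻¹) := by
    intro k hk
    have hkt : (k : ℝ) + 1 ≤ t := by exact_mod_cast Finset.mem_range.mp hk
    have hk0 : (0 : ℝ) < (k : ℝ) + 1 := by positivity
    have hk1 : (0 : ℝ) < (t : ℝ) - k := by linarith
    have hk2 : (t : ℝ) - k ≤ t := by linarith
    have e1 : (t : ℝ) ^ (-a) * (t : ℝ) ^ (1 - b) = (t : ℝ) ^ (1 - a - b) := by
      rw [← Real.rpow_add ht0]; ring_nf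
    have e2 : (t : ℝ) ^ (1 - a) * (t : ℝ) ^ (-b) = (t : ℝ) ^ (1 - a - b) := by
      rw [← Real.rpow_add ht0]; ring_nf
    have hp : 0 < (t : ℝ) ^ (1 - a - b) := by positivity
    rcases le_total ((t : ℝ) / 2) (k + 1) with h | h
    · calc ((k : ℝ) + 1) ^ (-a) * ((t : ℝ) - k) ^ (-b)
          ≤ (2 * (t : ℝ) ^ (-a)) * ((t : ℝ) ^ (1 - b) * ((t : ℝ) - k)⁻¹) := by
            gcongr
            · exact rpow_neg_le_two_mul ha0 ha1 ht0 h
            · exact rpow_neg_le_mul_inv hb1 hk1 hk2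
        _ = 2 * (t : ℝ) ^ (1 - a - b) * ((t : ℝ) - k)⁻¹ := by rw [← e1]; ring
        _ ≤ _ := by
            gcongr
            linarith [inv_pos.mpr hk0]
    · calc ((k : ℝ) + 1) ^ (-a) * ((t : ℝ) - k) ^ (-b)
          ≤ ((t : ℝ) ^ (1 - a) * ((k : ℝ) + 1)⁻¹) * (2 * (t : ℝ) ^ (-b)) := by
            gcongr
            · exact rpow_neg_le_mul_inv ha1 hk0 hkt
            · exact rpow_neg_le_two_mul hb0 hb1 ht0 (by linarith)
        _ = 2 * (t : ℝ) ^ (1 - a - b) * ((k : ℝ) + 1)⁻¹ := by rw [← e2]; ring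
        _ ≤ _ := by
            gcongr
            linarith [inv_pos.mpr hk1]
  have hrefl : ∑ k ∈ Finset.range t, ((t : ℝ) - k)⁻¹
      = ∑ k ∈ Finset.range t, ((k : ℝ) + 1)⁻¹ := by
    rw [← Finset.sum_range_reflect]
    refine Finset.sum_congr rfl fun k hk => ?_
    have hk' := Finset.mem_range.mp hk
    congr 1
    rw [Nat.cast_sub (by omega), Nat.cast_sub ht]
    push_cast
    ring
  have hp : 0 < (t : ℝ) ^ (1 - a - b) := by positivity
  calc _ ≤ ∑ k ∈ Finset.range t,
        2 * (t : ℝ) ^ (1 - a - b) * (((k : ℝ) + 1)⁻¹ + ((t : ℝ) - k)⁻¹) := Finset.sum_le_sum hpw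
    _ = 2 * (t : ℝ) ^ (1 - a - b) * (2 * ∑ k ∈ Finset.range t, ((k : ℝ) + 1)⁻¹) := by
        rw [← Finset.mul_sum, Finset.sum_add_distrib, hrefl, two_mul (∑ k ∈ _, _)]
    _ ≤ 2 * (t : ℝ) ^ (1 - a - b) * (2 * (1 + Real.log t)) := by
        gcongr
        exact sum_inv_succ_le t
    _ = _ := by ring

/-- A discrete Gronwall bound: if the total weight `W t` of the past tends to `0`, then the
sequence is bounded by a constant that depends only on the weights. -/
theorem exists_bound_of_weights_tendsto_zero (W : ℕ → ℝ)
    (hW : Filter.Tendsto W Filter.atTop (nhds 0)) (A S : ℝ) (hA : 0 ≤ A) (hS : 0 ≤ S) :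
    ∃ B : ℝ, 0 ≤ B ∧ ∀ (U : ℕ → ℝ≥0∞) (T : ℕ), U 0 ≤ ENNReal.ofReal A →
      (∀ t, t + 1 ≤ T → ∀ m : ℝ, 0 ≤ m → (∀ k ≤ t, U k ≤ ENNReal.ofReal m) →
        U (t + 1) ≤ ENNReal.ofReal (A + W (t + 1) * (m + S))) →
      ∀ t ≤ T, U t ≤ ENNReal.ofReal B := by
  -- At early times `W` need not be small; a bound that may grow with `n` suffices there, provided
  -- it is chosen before `U` and `T`.
  have hfin : ∀ n : ℕ, ∃ B : ℝ, 0 ≤ B ∧ ∀ (U : ℕ → ℝ≥0∞) (T : ℕ), U 0 ≤ ENNReal.ofReal A →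
      (∀ t, t + 1 ≤ T → ∀ m : ℝ, 0 ≤ m → (∀ k ≤ t, U k ≤ ENNReal.ofReal m) →
        U (t + 1) ≤ ENNReal.ofReal (A + W (t + 1) * (m + S))) →
      ∀ t ≤ n, t ≤ T → U t ≤ ENNReal.ofReal B := by
    intro n
    induction n with
    | zero =>
      refine ⟨A, hA, fun U T h0 _ t ht _ => ?_⟩
      obtain rfl : t = 0 := by omega
      exact h0
    | succ n ih =>
      obtain ⟨B, hB, h⟩ := ih
      refine ⟨max B (A + W (n + 1) * (B + S)), le_max_of_le_left hB,
        fun U T h0 hU t ht htT => ?_⟩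
      rcases Nat.lt_or_ge n t with h1 | h1
      · obtain rfl : t = n + 1 := by omega
        refine (hU n htT B hB fun k hk => h U T h0 hU k hk (by omega)).trans ?_
        exact ENNReal.ofReal_le_ofReal (le_max_right _ _)
      · exact (h U T h0 hU t h1 htT).trans (ENNReal.ofReal_le_ofReal (le_max_left _ _))
  -- Once `W t < 1/2`, a bound `m ≥ 2A + S` reproduces itself: `A + (m + S)/2 ≤ m`.
  have hev : ∀ᶠ t in Filter.atTop, W t < 1 / 2 := hW.eventually_lt_const (by norm_num)
  obtain ⟨n, hn⟩ := Filter.eventually_atTop.mp hev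
  obtain ⟨B, hB, h⟩ := hfin n
  refine ⟨max B (2 * A + S), le_max_of_le_left hB, fun U T h0 hU t => ?_⟩
  induction t using Nat.strong_induction_on with
  | _ t ih =>
    intro htT
    rcases Nat.lt_or_ge n t with h1 | h1
    · obtain ⟨s, rfl⟩ : ∃ s, t = s + 1 := ⟨t - 1, by omega⟩
      refine (hU s htT _ (le_max_of_le_left hB)
        fun k hk => ih k (by omega) (by omega)).trans (ENNReal.ofReal_le_ofReal ?_)
      have h2 := hn (s + 1) h1.le
      have h3 : 2 * A + S ≤ max B (2 * A + S) := le_max_right _ _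
      nlinarith
    · exact (h U T h0 hU t h1 htT).trans (ENNReal.ofReal_le_ofReal (le_max_left _ _))

/-! ### The deterministic recursion -/

/-- The step size sequence `η₁ k ^ (-θ)`. -/
noncomputable def stepSize (η₁ θ : ℝ) (k : ℕ) : ℝ := η₁ * (k : ℝ) ^ (-θ)

/-- The sum of the step sizes `η_{m+1}, …, η_t`. -/
noncomputable def stepSum (η₁ θ : ℝ) (m t : ℕ) : ℝ :=
  ∑ j ∈ Finset.Ico m t, stepSize η₁ θ (j + 1)

theorem stepSum_succ {η₁ θ : ℝ} {m t : ℕ} (h : m ≤ t) :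
    stepSum η₁ θ m (t + 1) = stepSum η₁ θ m t + stepSize η₁ θ (t + 1) :=
  Finset.sum_Ico_succ_top h _

theorem stepSize_le {η₁ θ : ℝ} (hη : 0 ≤ η₁) (hθ : 0 ≤ θ) (k : ℕ) :
    stepSize η₁ θ (k + 1) ≤ η₁ := by
  unfold stepSize
  refine mul_le_of_le_one_right hη (Real.rpow_le_one_of_one_le_of_nonpos ?_ (by linarith))
  push_cast
  linarith [(Nat.cast_nonneg k : (0 : ℝ) ≤ k)]

/-- The step sizes decrease, so each of them is at least the last one. -/
theorem mul_rpow_le_stepSum {η₁ θ : ℝ} (hη : 0 ≤ η₁) (hθ : 0 ≤ θ) {m t : ℕ} (h : m ≤ t) :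
    ((t : ℝ) - m) * (η₁ * (t : ℝ) ^ (-θ)) ≤ stepSum η₁ θ m t := by
  have : ∀ j ∈ Finset.Ico m t, η₁ * (t : ℝ) ^ (-θ) ≤ stepSize η₁ θ (j + 1) := by
    intro j hj
    unfold stepSize
    have hj' := (Finset.mem_Ico.mp hj).2
    gcongr η₁ * ?_
    refine Real.rpow_le_rpow_of_nonpos (by positivity) ?_ (by linarith)
    exact_mod_cast hj'
  have h2 := Finset.card_nsmul_le_sum _ _ _ this
  rw [Nat.card_Ico, nsmul_eq_mul, Nat.cast_sub h] at h2
  exact h2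

theorem sq_one_sub_le_exp {x : ℝ} (hx : x ≤ 1) : (1 - x) ^ 2 ≤ Real.exp (-(2 * x)) := by
  have h1 : 1 - x ≤ Real.exp (-x) := by linarith [Real.add_one_le_exp (-x)]
  calc (1 - x) ^ 2 ≤ Real.exp (-x) ^ 2 := by
        gcongr
    _ = Real.exp (-(2 * x)) := by rw [← Real.exp_nat_mul]; push_cast; ring_nf

/-- Unrolling the one-step inequality for the second moment of one coordinate. -/
theorem le_of_coordinate_recursion {η₁ θ b σ : ℝ} (hη : 0 ≤ η₁) (hθ : 0 ≤ θ) (hb : 0 ≤ b)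
    (hσ0 : 0 ≤ σ) (hσ : η₁ * σ ≤ 1) {u E : ℕ → ℝ≥0∞} {T : ℕ}
    (hu : ∀ t, t + 1 ≤ T → u (t + 1) ≤ ENNReal.ofReal ((1 - stepSize η₁ θ (t + 1) * σ) ^ 2) * u t
      + ENNReal.ofReal (b * stepSize η₁ θ (t + 1) ^ 2 * σ) * E t) :
    ∀ t ≤ T, u t ≤ ENNReal.ofReal (Real.exp (-(2 * (σ * stepSum η₁ θ 0 t)))) * u 0
      + ∑ k ∈ Finset.range t, ENNReal.ofReal (b * stepSize η₁ θ (k + 1) ^ 2 *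
          (σ * Real.exp (-(2 * (σ * stepSum η₁ θ (k + 1) t))))) * E k := by
  intro t
  induction t with
  | zero => intro _; simp [stepSum]
  | succ t ih =>
    intro htT
    -- This keeps the contraction factor nonnegative, so that its square is at most `exp(-2ησ)`.
    -- Noise entering at step `k + 1` is damped only by the later steps, hence `stepSum (k + 1) t`.
    have hst : stepSize η₁ θ (t + 1) * σ ≤ 1 :=
      (mul_le_mul_of_nonneg_right (stepSize_le hη hθ t) hσ0).trans hσ
    have hq : ENNReal.ofReal ((1 - stepSize η₁ θ (t + 1) * σ) ^ 2)
        ≤ ENNReal.ofReal (Real.exp (-(2 * (stepSize η₁ θ (t + 1) * σ)))) :=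
      ENNReal.ofReal_le_ofReal (sq_one_sub_le_exp hst)
    refine (hu t htT).trans ?_
    rw [Finset.sum_range_succ, ← add_assoc]
    gcongr
    · refine (mul_le_mul' hq (ih (by omega))).trans (le_of_eq ?_)
      rw [mul_add, ← mul_assoc, ← ENNReal.ofReal_mul (Real.exp_pos _).le, ← Real.exp_add,
        stepSum_succ (Nat.zero_le t), Finset.mul_sum]
      congr 1
      · congr 3; ring
      · refine Finset.sum_congr rfl fun k hk => ?_
        rw [← mul_assoc, ← ENNReal.ofReal_mul (Real.exp_pos _).le]
        rw [stepSum_succ (Finset.mem_range.mp hk)]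
        have : Real.exp (-(2 * (σ * (stepSum η₁ θ (k + 1) t + stepSize η₁ θ (t + 1)))))
            = Real.exp (-(2 * (stepSize η₁ θ (t + 1) * σ)))
              * Real.exp (-(2 * (σ * stepSum η₁ θ (k + 1) t))) := by
          rw [← Real.exp_add]; ring_nf
        rw [this]
        congr 2; ring
    · simp [stepSum]

/-- The trace of `L exp (-2 p L)` under the capacity condition. -/
theorem tsum_mul_exp_le {ι : Type*} {σ : ι → ℝ} {c γ p q : ℝ} (hσ0 : ∀ i, 0 ≤ σ i)
    (hcap : ∀ lam : ℝ, 0 < lam →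
      ∑' i, ENNReal.ofReal (σ i / (σ i + lam)) ≤ ENNReal.ofReal (c * lam ^ (-γ)))
    (hq : 0 < q) (hpq : ∀ i, σ i * q ≤ σ i * p + 1) :
    ∑' i, ENNReal.ofReal (σ i * Real.exp (-(2 * (σ i * p))))
      ≤ ENNReal.ofReal (Real.exp 2 * c * q ^ (γ - 1)) := by
  have hqi : 0 < q⁻¹ := inv_pos.mpr hq
  calc ∑' i, ENNReal.ofReal (σ i * Real.exp (-(2 * (σ i * p))))
      ≤ ∑' i, ENNReal.ofReal (Real.exp 2 * q⁻¹) * ENNReal.ofReal (σ i / (σ i + q⁻¹)) := by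
        refine ENNReal.tsum_le_tsum fun i => ?_
        rw [← ENNReal.ofReal_mul (by positivity)]
        refine ENNReal.ofReal_le_ofReal ?_
        -- The slack `1` in `hpq` costs the factor `exp 2`; it allows `p = 0`, which occurs for the
        -- most recent noise.
        have h1 : Real.exp (-(2 * (σ i * p))) ≤ Real.exp 2 * Real.exp (-(2 * (σ i * q))) := by
          rw [← Real.exp_add]
          exact Real.exp_le_exp.mpr (by linarith [hpq i])
        calc σ i * Real.exp (-(2 * (σ i * p)))
            ≤ σ i * (Real.exp 2 * Real.exp (-(2 * (σ i * q)))) := by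
              gcongr
              exact hσ0 i
          _ = Real.exp 2 * (σ i * Real.exp (-(2 * (σ i * q)))) := by ring
          _ ≤ Real.exp 2 * (σ i / (σ i + q⁻¹) * q⁻¹) := by
              exact mul_le_mul_of_nonneg_left (mul_exp_neg_le_div (hσ0 i) hq) (Real.exp_pos _).le
          _ = _ := by ring
    _ = ENNReal.ofReal (Real.exp 2 * q⁻¹) * ∑' i, ENNReal.ofReal (σ i / (σ i + q⁻¹)) :=
        ENNReal.tsum_mul_left
    _ ≤ ENNReal.ofReal (Real.exp 2 * q⁻¹) * ENNReal.ofReal (c * q⁻¹ ^ (-γ)) := by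
        gcongr
        exact hcap _ hqi
    _ = _ := by
        rw [← ENNReal.ofReal_mul (by positivity), Real.inv_rpow hq.le, Real.rpow_neg hq.le, inv_inv,
          Real.rpow_sub hq, Real.rpow_one]
        congr 1
        field_simp

/-- The bias term `‖exp (-s L) L ^ ζ g‖²`. -/
theorem tsum_bias_le {ι : Type*} {σ g : ι → ℝ} {ζ R s : ℝ} {u₀ : ι → ℝ≥0∞} (hζ : 0 < ζ)
    (hσ0 : ∀ i, 0 ≤ σ i) (hs : 0 < s)
    (hu : ∀ i, u₀ i ≤ ENNReal.ofReal (σ i ^ (2 * ζ) * g i ^ 2))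
    (hg : ∑' i, ENNReal.ofReal (g i ^ 2) ≤ ENNReal.ofReal (R ^ 2)) :
    ∑' i, ENNReal.ofReal (Real.exp (-(2 * (σ i * s)))) * u₀ i
      ≤ ENNReal.ofReal ((2 * ζ) ^ (2 * ζ) * R ^ 2 * s ^ (-(2 * ζ))) := by
  calc ∑' i, ENNReal.ofReal (Real.exp (-(2 * (σ i * s)))) * u₀ i
      ≤ ∑' i, ENNReal.ofReal ((2 * ζ) ^ (2 * ζ) * s ^ (-(2 * ζ))) * ENNReal.ofReal (g i ^ 2) := by
        refine ENNReal.tsum_le_tsum fun i => (mul_le_mul_right (hu i) _).trans ?_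
        rw [← ENNReal.ofReal_mul (Real.exp_pos _).le, ← ENNReal.ofReal_mul (by positivity)]
        refine ENNReal.ofReal_le_ofReal ?_
        rw [← mul_assoc, mul_comm (Real.exp _)]
        exact mul_le_mul_of_nonneg_right
          (rpow_mul_exp_neg_mul_le (by positivity) (hσ0 i) hs) (sq_nonneg _)
    _ ≤ ENNReal.ofReal ((2 * ζ) ^ (2 * ζ) * s ^ (-(2 * ζ))) * ENNReal.ofReal (R ^ 2) := by
        rw [ENNReal.tsum_mul_left]
        gcongr
    _ = _ := by
        rw [← ENNReal.ofReal_mul (by positivity)]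
        congr 1; ring

/-- A convolution sum with exponents `2θ` and `1 - γ`; `θ ≤ 1/2` keeps the first one at most `1`.
The powers of `t` add up to `θ(1-γ) + 1 - 2θ - (1-γ) = γ - θ(1+γ)`. -/
theorem sum_weights_le {κ c γ θ η₁ : ℝ} (hc : 0 ≤ c) (hγ0 : 0 ≤ γ) (hγ1 : γ ≤ 1) (hθ0 : 0 ≤ θ)
    (hθ : θ ≤ 1 / 2) (hη : 0 < η₁) {t : ℕ} (ht : 1 ≤ t) :
    ∑ k ∈ Finset.range t, κ ^ 2 * stepSize η₁ θ (k + 1) ^ 2 *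
        (Real.exp 2 * c * (((t : ℝ) - k) * (η₁ * (t : ℝ) ^ (-θ))) ^ (γ - 1))
      ≤ 4 * κ ^ 2 * η₁ ^ 2 * Real.exp 2 * c * η₁ ^ (γ - 1) *
        ((t : ℝ) ^ (-(θ * (1 + γ) - γ)) * (1 + Real.log t)) := by
  have ht0 : (0 : ℝ) < t := by exact_mod_cast ht
  set A := κ ^ 2 * η₁ ^ 2 * Real.exp 2 * c * η₁ ^ (γ - 1) with hA
  have hA0 : 0 ≤ A := by positivity
  have hterm : ∀ k ∈ Finset.range t, κ ^ 2 * stepSize η₁ θ (k + 1) ^ 2 *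
        (Real.exp 2 * c * (((t : ℝ) - k) * (η₁ * (t : ℝ) ^ (-θ))) ^ (γ - 1))
      = A * (t : ℝ) ^ (θ * (1 - γ)) *
        (((k : ℝ) + 1) ^ (-(2 * θ)) * ((t : ℝ) - k) ^ (-(1 - γ))) := by
    intro k hk
    have hkt : (k : ℝ) < t := by exact_mod_cast Finset.mem_range.mp hk
    have hk1 : (0 : ℝ) ≤ (t : ℝ) - k := by linarith
    rw [stepSize, Real.mul_rpow hk1 (by positivity), Real.mul_rpow hη.le (by positivity),
      ← Real.rpow_mul ht0.le, mul_pow, ← Real.rpow_natCast (_ ^ (-θ)) 2,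
      ← Real.rpow_mul (by positivity)]
    push_cast
    rw [show -θ * (γ - 1) = θ * (1 - γ) by ring, show -θ * 2 = -(2 * θ) by ring,
      show γ - 1 = -(1 - γ) by ring, hA, show γ - 1 = -(1 - γ) by ring]
    ring
  rw [Finset.sum_congr rfl hterm, ← Finset.mul_sum]
  calc _ ≤ A * (t : ℝ) ^ (θ * (1 - γ)) *
        (4 * (t : ℝ) ^ (1 - 2 * θ - (1 - γ)) * (1 + Real.log t)) := by
        gcongr
        exact sum_rpow_mul_rpow_le (by linarith) (by linarith) (by linarith) (by linarith) ht
    _ = 4 * A * ((t : ℝ) ^ (θ * (1 - γ)) * (t : ℝ) ^ (1 - 2 * θ - (1 - γ)) *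
        (1 + Real.log t)) := by ring
    _ = _ := by
        rw [← Real.rpow_add ht0, hA]
        ring_nf

/-- One step of the Gronwall argument: a uniform bound on the past improves to a decaying one. -/
theorem tsum_le_of_recursion {κ c γ ζ R S θ η₁ : ℝ} (hc : 0 ≤ c) (hγ0 : 0 ≤ γ)
    (hγ1 : γ ≤ 1) (hζ : 0 < ζ) (hS : 0 ≤ S) (hθ0 : 0 ≤ θ) (hθ : θ ≤ 1 / 2) (hη : 0 < η₁)
    (hηκ : η₁ * κ ^ 2 ≤ 1) {ι : Type*} {σ g : ι → ℝ} {u : ℕ → ι → ℝ≥0∞} {T : ℕ}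
    (hσ0 : ∀ i, 0 ≤ σ i) (hσ : ∀ i, σ i ≤ κ ^ 2)
    (hcap : ∀ lam : ℝ, 0 < lam →
      ∑' i, ENNReal.ofReal (σ i / (σ i + lam)) ≤ ENNReal.ofReal (c * lam ^ (-γ)))
    (hu0 : ∀ i, u 0 i ≤ ENNReal.ofReal (σ i ^ (2 * ζ) * g i ^ 2))
    (hg : ∑' i, ENNReal.ofReal (g i ^ 2) ≤ ENNReal.ofReal (R ^ 2))
    (hu : ∀ t, t + 1 ≤ T → ∀ i, u (t + 1) i
      ≤ ENNReal.ofReal ((1 - stepSize η₁ θ (t + 1) * σ i) ^ 2) * u t i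
        + ENNReal.ofReal (κ ^ 2 * stepSize η₁ θ (t + 1) ^ 2 * σ i) *
          (∑' j, u t j + ENNReal.ofReal S))
    {t : ℕ} (ht : 1 ≤ t) (htT : t ≤ T) {m : ℝ} (hm : 0 ≤ m)
    (hU : ∀ k < t, ∑' i, u k i ≤ ENNReal.ofReal m) :
    ∑' i, u t i ≤ ENNReal.ofReal
      ((2 * ζ) ^ (2 * ζ) * R ^ 2 * η₁ ^ (-(2 * ζ)) * (t : ℝ) ^ (-(2 * ζ * (1 - θ)))
        + 4 * κ ^ 2 * η₁ ^ 2 * Real.exp 2 * c * η₁ ^ (γ - 1) *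
        ((t : ℝ) ^ (-(θ * (1 + γ) - γ)) * (1 + Real.log t)) * (m + S)) := by
  have ht0 : (0 : ℝ) < t := by exact_mod_cast ht
  have ht1 : (1 : ℝ) ≤ t := by exact_mod_cast ht
  have hησ : ∀ i, η₁ * σ i ≤ 1 := fun i =>
    (mul_le_mul_of_nonneg_left (hσ i) hη.le).trans hηκ
  have h1 : ∀ i, u t i ≤ ENNReal.ofReal (Real.exp (-(2 * (σ i * stepSum η₁ θ 0 t)))) * u 0 i
      + ∑ k ∈ Finset.range t, ENNReal.ofReal (κ ^ 2 * stepSize η₁ θ (k + 1) ^ 2 *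
          (σ i * Real.exp (-(2 * (σ i * stepSum η₁ θ (k + 1) t))))) *
            (∑' j, u k j + ENNReal.ofReal S) := fun i =>
    le_of_coordinate_recursion (u := fun t => u t i) hη.le hθ0 (sq_nonneg κ) (hσ0 i) (hησ i)
      (fun t ht => hu t ht i) t htT
  refine (ENNReal.tsum_le_tsum h1).trans ?_
  rw [ENNReal.tsum_add, Summable.tsum_finsetSum fun _ _ => ENNReal.summable]
  have hpos : 0 ≤ 1 + Real.log t := by linarith [Real.log_nonneg ht1]
  rw [ENNReal.ofReal_add (by positivity) (by positivity)]
  have hs0 : η₁ * (t : ℝ) ^ (1 - θ) ≤ stepSum η₁ θ 0 t := by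
    have := mul_rpow_le_stepSum hη.le hθ0 (Nat.zero_le t)
    rw [show (1 - θ) = 1 + (-θ) by ring, Real.rpow_add ht0, Real.rpow_one]
    simp only [Nat.cast_zero, sub_zero] at this
    linarith
  have hs1 : 0 < η₁ * (t : ℝ) ^ (1 - θ) := by positivity
  gcongr
  · refine (tsum_bias_le hζ hσ0 (hs1.trans_le hs0) hu0 hg).trans (ENNReal.ofReal_le_ofReal ?_)
    rw [mul_assoc _ (η₁ ^ _)]
    gcongr
    calc stepSum η₁ θ 0 t ^ (-(2 * ζ)) ≤ (η₁ * (t : ℝ) ^ (1 - θ)) ^ (-(2 * ζ)) :=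
          Real.rpow_le_rpow_of_nonpos hs1 hs0 (by linarith)
      _ = _ := by
          rw [Real.mul_rpow hη.le (by positivity), ← Real.rpow_mul ht0.le]
          ring_nf
  · calc _ ≤ ∑ k ∈ Finset.range t, ENNReal.ofReal (κ ^ 2 * stepSize η₁ θ (k + 1) ^ 2 *
            (Real.exp 2 * c * (((t : ℝ) - k) * (η₁ * (t : ℝ) ^ (-θ))) ^ (γ - 1))) *
            ENNReal.ofReal (m + S) := by
          refine Finset.sum_le_sum fun k hk => ?_
          have hk' := Finset.mem_range.mp hk
          have hkt : (k : ℝ) < t := by exact_mod_cast hk'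
          rw [ENNReal.tsum_mul_right, ENNReal.ofReal_add hm hS]
          gcongr
          · simp_rw [ENNReal.ofReal_mul (by positivity :
              0 ≤ κ ^ 2 * stepSize η₁ θ (k + 1) ^ 2)]
            rw [ENNReal.tsum_mul_left]
            gcongr
            have hpos : 0 < ((t : ℝ) - k) * (η₁ * (t : ℝ) ^ (-θ)) :=
              mul_pos (by linarith) (by positivity)
            refine tsum_mul_exp_le hσ0 hcap hpos fun i => ?_
            -- Only `t - k - 1` damping steps remain, against `t - k` in the target. The missing one
            -- contributes at most `η₁ σᵢ t^(-θ) ≤ 1`, the slack allowed in `tsum_mul_exp_le`.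
            have h2 := mul_rpow_le_stepSum hη.le hθ0 (show k + 1 ≤ t from hk')
            push_cast at h2
            have h3 := mul_le_mul_of_nonneg_left h2 (hσ0 i)
            have h4 : (t : ℝ) ^ (-θ) ≤ 1 :=
              Real.rpow_le_one_of_one_le_of_nonpos ht1 (by linarith)
            have h5 : η₁ * σ i * (t : ℝ) ^ (-θ) ≤ 1 :=
              mul_le_one₀ (hησ i) (by positivity) h4
            linarith
          · exact hU k hk'
      _ = ENNReal.ofReal ((∑ k ∈ Finset.range t, κ ^ 2 * stepSize η₁ θ (k + 1) ^ 2 *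
            (Real.exp 2 * c * (((t : ℝ) - k) * (η₁ * (t : ℝ) ^ (-θ))) ^ (γ - 1))) * (m + S)) := by
          have hnn : ∀ k ∈ Finset.range t, 0 ≤ κ ^ 2 * stepSize η₁ θ (k + 1) ^ 2 *
              (Real.exp 2 * c * (((t : ℝ) - k) * (η₁ * (t : ℝ) ^ (-θ))) ^ (γ - 1)) := by
            intro k hk
            have hkt : (k : ℝ) < t := by exact_mod_cast Finset.mem_range.mp hk
            have : 0 ≤ (t : ℝ) - k := by linarith
            positivity
          rw [ENNReal.ofReal_mul (Finset.sum_nonneg hnn), ENNReal.ofReal_sum_of_nonneg hnn,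
            Finset.sum_mul]
      _ ≤ _ := by
          refine ENNReal.ofReal_le_ofReal ?_
          gcongr
          exact sum_weights_le hc hγ0 hγ1 hθ0 hθ hη ht

theorem tendsto_rpow_neg_mul_log {a : ℝ} (ha : 0 < a) :
    Filter.Tendsto (fun t : ℕ => (t : ℝ) ^ (-a) * (1 + Real.log t)) Filter.atTop (nhds 0) := by
  have h1 : Filter.Tendsto (fun x : ℝ => x ^ (-a)) Filter.atTop (nhds 0) :=
    tendsto_rpow_neg_atTop ha
  have h2 : Filter.Tendsto (fun x : ℝ => Real.log x / x ^ a) Filter.atTop (nhds 0) :=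
    (isLittleO_log_rpow_atTop ha).tendsto_div_nhds_zero
  have h3 := (h1.add h2).comp tendsto_natCast_atTop_atTop
  rw [add_zero] at h3
  refine h3.congr fun t => ?_
  simp only [Function.comp_apply]
  rw [Real.rpow_neg (Nat.cast_nonneg t)]
  ring

/-- The learning rate implied by the coordinatewise recursion. -/
theorem exists_rate_of_recursion {κ c γ ζ R S θ η₁ : ℝ} (hc : 0 ≤ c) (hγ0 : 0 ≤ γ)
    (hγ1 : γ ≤ 1) (hζ : 0 < ζ) (hS : 0 ≤ S) (hθ0 : 0 ≤ θ) (hθ : θ ≤ 1 / 2) (hη : 0 < η₁)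
    (hηκ : η₁ * κ ^ 2 ≤ 1) (hα : 0 < θ * (1 + γ) - γ) :
    ∃ C : ℝ, 0 < C ∧ ∀ {ι : Type*} (σ g : ι → ℝ) (u : ℕ → ι → ℝ≥0∞) (T : ℕ),
      (∀ i, 0 ≤ σ i) → (∀ i, σ i ≤ κ ^ 2) →
      (∀ lam : ℝ, 0 < lam →
        ∑' i, ENNReal.ofReal (σ i / (σ i + lam)) ≤ ENNReal.ofReal (c * lam ^ (-γ))) →
      (∀ i, u 0 i ≤ ENNReal.ofReal (σ i ^ (2 * ζ) * g i ^ 2)) →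
      (∑' i, ENNReal.ofReal (g i ^ 2) ≤ ENNReal.ofReal (R ^ 2)) →
      (∀ t, t + 1 ≤ T → ∀ i, u (t + 1) i
        ≤ ENNReal.ofReal ((1 - stepSize η₁ θ (t + 1) * σ i) ^ 2) * u t i
          + ENNReal.ofReal (κ ^ 2 * stepSize η₁ θ (t + 1) ^ 2 * σ i) *
            (∑' j, u t j + ENNReal.ofReal S)) →
      ∀ t, 2 ≤ t → t ≤ T → ∑' i, u t i ≤ ENNReal.ofReal
        (C * (((t : ℝ) ^ (-(2 * ζ * (1 - θ))) + (t : ℝ) ^ (-(θ * (1 + γ) - γ))) *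
          Real.log t)) := by
  set b := (2 * ζ) ^ (2 * ζ) * R ^ 2 * η₁ ^ (-(2 * ζ)) with hb
  set w := 4 * κ ^ 2 * η₁ ^ 2 * Real.exp 2 * c * η₁ ^ (γ - 1) with hw
  have hb0 : 0 ≤ b := by positivity
  have hw0 : 0 ≤ w := by positivity
  have htend := (tendsto_rpow_neg_mul_log hα).const_mul w
  rw [mul_zero] at htend
  -- The first summand bounds the initial error through `σᵢ ≤ κ²`, the second the bias at every
  -- later time.
  obtain ⟨B, hB0, hB⟩ := exists_bound_of_weights_tendsto_zero _ htend
    ((κ ^ 2) ^ (2 * ζ) * R ^ 2 + b) S (by positivity) hS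
  -- For `t ≥ 2` one has `1 ≤ 2 log t` and `1 + log t ≤ 3 log t`: hence `2` for the bias and `3` for
  -- the variance. The final `1` ensures positivity.
  refine ⟨2 * b + 3 * (w * (B + S)) + 1, by positivity, ?_⟩
  intro ι σ g u T hσ0 hσ hcap hu0 hg hu t ht htT
  have hbd : ∀ k ≤ T, ∑' i, u k i ≤ ENNReal.ofReal B := by
    refine hB (fun k => ∑' i, u k i) T ?_ ?_
    · calc ∑' i, u 0 i ≤ ∑' i, ENNReal.ofReal ((κ ^ 2) ^ (2 * ζ)) * ENNReal.ofReal (g i ^ 2) := by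
            refine ENNReal.tsum_le_tsum fun i => (hu0 i).trans ?_
            rw [← ENNReal.ofReal_mul (by positivity)]
            refine ENNReal.ofReal_le_ofReal ?_
            gcongr
            · exact hσ0 i
            · exact hσ i
        _ ≤ ENNReal.ofReal ((κ ^ 2) ^ (2 * ζ)) * ENNReal.ofReal (R ^ 2) := by
            rw [ENNReal.tsum_mul_left]
            gcongr
        _ ≤ _ := by
            rw [← ENNReal.ofReal_mul (by positivity)]
            exact ENNReal.ofReal_le_ofReal (by linarith)
    · intro s hs m hm hU
      refine (tsum_le_of_recursion hc hγ0 hγ1 hζ hS hθ0 hθ hη hηκ hσ0 hσ hcap hu0 hg hu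
        (Nat.le_add_left 1 s) hs hm fun k hk => hU k (by omega)).trans
          (ENNReal.ofReal_le_ofReal ?_)
      have h1 : ((s + 1 : ℕ) : ℝ) ^ (-(2 * ζ * (1 - θ))) ≤ 1 := by
        refine Real.rpow_le_one_of_one_le_of_nonpos (by exact_mod_cast Nat.le_add_left 1 s) ?_
        have : 0 ≤ 2 * ζ * (1 - θ) := mul_nonneg (by linarith) (by linarith)
        linarith
      have h2 := mul_le_mul_of_nonneg_left h1 hb0
      have h3 : 0 ≤ (κ ^ 2) ^ (2 * ζ) * R ^ 2 := by positivity
      linarith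
  refine (tsum_le_of_recursion hc hγ0 hγ1 hζ hS hθ0 hθ hη hηκ hσ0 hσ hcap hu0 hg hu
    (by omega) htT hB0 fun k hk => hbd k (by omega)).trans (ENNReal.ofReal_le_ofReal ?_)
  have hlog : 1 ≤ 2 * Real.log t := by
    have h1 : Real.log 2 ≤ Real.log t :=
      Real.log_le_log (by norm_num) (by exact_mod_cast ht)
    linarith [Real.log_two_gt_d9]
  have hX : 0 ≤ (t : ℝ) ^ (-(2 * ζ * (1 - θ))) := by positivity
  have hY : 0 ≤ (t : ℝ) ^ (-(θ * (1 + γ) - γ)) := by positivity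
  set X := (t : ℝ) ^ (-(2 * ζ * (1 - θ)))
  set Y := (t : ℝ) ^ (-(θ * (1 + γ) - γ))
  set l := Real.log t
  have hBS : 0 ≤ w * (B + S) := by positivity
  have hl0 : 0 ≤ l := by linarith
  have e1 : b * X ≤ b * X * (2 * l) := le_mul_of_one_le_right (by positivity) hlog
  have e2 : w * (Y * (1 + l)) * (B + S) ≤ w * (B + S) * Y * (3 * l) := by
    have : w * (Y * (1 + l)) * (B + S) = w * (B + S) * Y * (1 + l) := by ring
    rw [this]
    gcongr
    linarith
  have e3 : 0 ≤ (3 * (w * (B + S)) + 1) * X * l := by positivity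
  have e4 : 0 ≤ (2 * b + 1) * Y * l := by positivity
  linarith

/-! ### Compact self-adjoint operators -/

section Hilbert

variable {H : Type*} [NormedAddCommGroup H] [InnerProductSpace ℝ H]

theorem hasSum_inner_sq {ι : Type*} (b : HilbertBasis ι ℝ H) (x : H) :
    HasSum (fun i => ⟪b i, x⟫_ℝ ^ 2) (‖x‖ ^ 2) := by
  have h := b.hasSum_inner_mul_inner x x
  rw [real_inner_self_eq_norm_sq] at h
  have h2 : (fun i => ⟪b i, x⟫_ℝ ^ 2) = fun i => ⟪x, b i⟫_ℝ * ⟪b i, x⟫_ℝ := by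
    funext i
    rw [real_inner_comm x, sq]
  rw [h2]
  exact h

theorem tsum_ofReal_inner_sq {ι : Type*} (b : HilbertBasis ι ℝ H) (x : H) :
    ∑' i, ENNReal.ofReal (⟪b i, x⟫_ℝ ^ 2) = ENNReal.ofReal (‖x‖ ^ 2) := by
  rw [← ENNReal.ofReal_tsum_of_nonneg (fun _ => sq_nonneg _) (hasSum_inner_sq b x).summable,
    (hasSum_inner_sq b x).tsum_eq]

/-- Orthonormal vectors lie at distance `√2`, so the balls of radius `1/2` about them are disjoint.
Countability is what permits exchanging the sum over coordinates with the expectation. -/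
theorem countable_of_hilbertBasis [TopologicalSpace.SeparableSpace H] {ι : Type*}
    (b : HilbertBasis ι ℝ H) : Countable ι := by
  refine Pairwise.countable_of_isOpen_disjoint (s := fun i => Metric.ball (b i) (1 / 2)) ?_
    (fun _ => Metric.isOpen_ball) fun i => ⟨b i, Metric.mem_ball_self (by norm_num)⟩
  intro i j hij
  refine Metric.ball_disjoint_ball ?_
  have h1 : ‖b i - b j‖ ^ 2 = 2 := by
    rw [norm_sub_sq_real, b.orthonormal.1 i, b.orthonormal.1 j, b.orthonormal.2 hij]
    norm_num
  rw [dist_eq_norm]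
  nlinarith [norm_nonneg (b i - b j)]

variable [CompleteSpace H]

/-- A Hilbert–Schmidt operator is compact. -/
theorem isCompactOperator_of_summable_norm_sq {ι : Type*} (b : HilbertBasis ι ℝ H) (L : H →L[ℝ] H)
    (hL : Summable fun i => ‖L (b i)‖ ^ 2) : IsCompactOperator L := by
  -- Finite-rank truncations; by Cauchy–Schwarz the operator norm of the remainder is at most the
  -- square root of the tail of `∑ ‖L bᵢ‖²`.
  let F : Finset ι → H →L[ℝ] H := fun s =>
    ∑ i ∈ s, (innerSL ℝ (b i)).smulRight (L (b i))
  have hF : ∀ s, IsCompactOperator (F s) := by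
    intro s
    have h1 : ∀ i, (innerSL ℝ (b i)).smulRight (L (b i)) ∈ compactOperator (RingHom.id ℝ) H H := by
      intro i
      have h2 : IsCompactOperator (innerSL ℝ (b i)) :=
        isCompactOperator_of_locallyCompactSpace_dom (innerSL ℝ (b i))
      exact h2.clm_comp (ContinuousLinearMap.toSpanSingleton ℝ (L (b i)))
    exact Submodule.sum_mem _ fun i _ => h1 i
  set τ : Finset ι → ℝ := fun s => ∑' i : { i // i ∉ s }, ‖L (b i)‖ ^ 2 with hτ
  have hτ0 : Filter.Tendsto τ Filter.atTop (nhds 0) := tendsto_tsum_compl_atTop_zero fun i => ‖L (b i)‖ ^ 2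
  have hbd : ∀ s, ‖F s - L‖ ≤ Real.sqrt (τ s) := by
    intro s
    refine ContinuousLinearMap.opNorm_le_bound _ (Real.sqrt_nonneg _) fun x => ?_
    have h1 : HasSum (fun i => ⟪b i, x⟫_ℝ • L (b i)) (L x) := by
      have h2 := (b.hasSum_repr x).mapL L
      simpa only [map_smul, b.repr_apply_apply] using h2
    have h3 : Filter.Tendsto (fun G : Finset ι => ‖F s x - ∑ i ∈ G, ⟪b i, x⟫_ℝ • L (b i)‖)
        Filter.atTop (nhds ‖(F s - L) x‖) := (tendsto_const_nhds.sub h1).norm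
    refine le_of_tendsto h3 ?_
    classical
    filter_upwards [Filter.eventually_ge_atTop s] with G hG
    have h4 : F s x = ∑ i ∈ s, ⟪b i, x⟫_ℝ • L (b i) := by
      simp [F]
    rw [h4, ← Finset.sum_sdiff hG, sub_add_cancel_right, norm_neg]
    have h5 : ∑ i ∈ G \ s, ‖L (b i)‖ ^ 2 ≤ τ s := by
      have h8 : Summable fun i : { i // i ∉ s } => ‖L (b i)‖ ^ 2 := hL.subtype _
      have h6 := h8.sum_le_tsum ((G \ s).subtype (fun i => i ∉ s)) fun _ _ => sq_nonneg _
      refine le_trans (le_of_eq ?_) h6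
      rw [← Finset.sum_subtype_of_mem (p := fun i => i ∉ s) (fun i => ‖L (b i)‖ ^ 2)
        fun i hi => (Finset.mem_sdiff.mp hi).2]
    have h7 : ∑ i ∈ G \ s, ⟪b i, x⟫_ℝ ^ 2 ≤ ‖x‖ ^ 2 :=
      sum_le_hasSum _ (fun _ _ => sq_nonneg _) (hasSum_inner_sq b x)
    calc ‖∑ i ∈ G \ s, ⟪b i, x⟫_ℝ • L (b i)‖ ≤ ∑ i ∈ G \ s, |⟪b i, x⟫_ℝ| * ‖L (b i)‖ := by
          refine (norm_sum_le _ _).trans (le_of_eq (Finset.sum_congr rfl fun i _ => ?_))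
          rw [norm_smul, Real.norm_eq_abs]
      _ ≤ Real.sqrt (∑ i ∈ G \ s, |⟪b i, x⟫_ℝ| ^ 2) * Real.sqrt (∑ i ∈ G \ s, ‖L (b i)‖ ^ 2) :=
          Real.sum_mul_le_sqrt_mul_sqrt _ _ _
      _ ≤ Real.sqrt (‖x‖ ^ 2) * Real.sqrt (τ s) := by
          simp only [sq_abs]
          gcongr
      _ = Real.sqrt (τ s) * ‖x‖ := by
          rw [Real.sqrt_sq (norm_nonneg _), mul_comm]
  refine isCompactOperator_of_tendsto (F := F) (l := Filter.atTop) ?_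
    (Filter.Eventually.of_forall hF)
  rw [tendsto_iff_norm_sub_tendsto_zero]
  refine squeeze_zero (fun _ => norm_nonneg _) hbd ?_
  simpa using hτ0.sqrt

/-- The spectral theorem for compact self-adjoint operators: there is a Hilbert basis of
eigenvectors. -/
theorem exists_hilbertBasis_eigenvectors (L : H →L[ℝ] H) (hL : IsCompactOperator L)
    (hs : (L : H →ₗ[ℝ] H).IsSymmetric) :
    ∃ (w : Set H) (b : HilbertBasis w ℝ H) (σ : w → ℝ), ∀ i, L (b i) = σ i • b i := by
  set E : ℝ → Submodule ℝ H := fun μ => Module.End.eigenspace (L : Module.End ℝ H) μ with hE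
  have hcl : ∀ μ, IsClosed (E μ : Set H) := by
    intro μ
    have : (E μ : Set H) = {x | L x = μ • x} := by
      ext x
      simp [hE]
    rw [this]
    exact isClosed_eq L.continuous (continuous_const_smul μ)
  have hco : ∀ μ, CompleteSpace (E μ) := fun μ => (hcl μ).completeSpace_coe
  -- A basis of every eigenspace; it is empty when `μ` is not an eigenvalue. Distinct eigenspaces
  -- are orthogonal, so the union is orthonormal.
  choose v c hc using fun μ => exists_hilbertBasis ℝ (E μ)
  have hon := hs.orthogonalFamily_eigenspaces.orthonormal_sigma_orthonormal
    (v_family := fun μ => (c μ : v μ → E μ)) fun μ => (c μ).orthonormal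
  have hon2 := hon.toSubtypeRange
  -- A vector orthogonal to all the bases is orthogonal to every eigenspace, and for a compact
  -- self-adjoint operator only `0` is.
  have hbot : (Submodule.span ℝ (Set.range ((↑) : Set.range
      (fun a : Σ μ, v μ => (E a.1).subtypeₗᵢ (c a.1 a.2)) → H)))ᗮ = ⊥ := by
    rw [Subtype.range_coe_subtype, Set.ofPred_mem_eq, eq_bot_iff,
      ← L.orthogonalComplement_iSup_eigenspaces_eq_bot hL hs]
    intro x hx
    have hx' : ∀ μ (i : v μ), ⟪((c μ i : E μ) : H), x⟫_ℝ = 0 := fun μ i =>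
      (Submodule.mem_orthogonal _ _).mp hx _ (Submodule.subset_span ⟨⟨μ, i⟩, rfl⟩)
    rw [← Submodule.iInf_orthogonal, Submodule.mem_iInf]
    intro μ
    rw [Submodule.mem_orthogonal]
    intro y hy
    have h1 : HasSum (fun i => (c μ).repr ⟨y, hy⟩ i • ((c μ i : E μ) : H)) y :=
      ((c μ).hasSum_repr ⟨y, hy⟩).mapL (E μ).subtypeL
    have h2 := h1.mapL (innerSL ℝ x)
    simp only [map_smul, innerSL_apply_apply] at h2
    rw [real_inner_comm]
    refine h2.unique ?_
    have : (fun i => (c μ).repr ⟨y, hy⟩ i • ⟪x, ((c μ i : E μ) : H)⟫_ℝ) = fun _ => 0 := by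
      funext i
      rw [real_inner_comm, hx', smul_zero]
    rw [this]
    exact hasSum_zero
  refine ⟨_, HilbertBasis.mkOfOrthogonalEqBot hon2 hbot, ?_⟩
  have : ∀ i : Set.range (fun a : Σ μ, v μ => (E a.1).subtypeₗᵢ (c a.1 a.2)),
      ∃ s : ℝ, L (i : H) = s • (i : H) := by
    rintro ⟨_, ⟨μ, i⟩, rfl⟩
    exact ⟨μ, Module.End.mem_eigenspace_iff.mp (c μ i).2⟩
  choose σ hσ using this
  refine ⟨σ, fun i => ?_⟩
  rw [HilbertBasis.coe_mkOfOrthogonalEqBot]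
  exact hσ i

/-- The spectral projections are self-adjoint and all but `P_σ` kill `x`, so a single term of the
series survives the pairing. Only an inequality is claimed because a non-summable series has the
default value `0`. -/
theorem sq_inner_opRpow_le (L : H →L[ℝ] H) (hs : (L : H →ₗ[ℝ] H).IsSymmetric) {s σ : ℝ} {x : H}
    (hx : L x = σ • x) (g : H) :
    ⟪x, opRpow L s g⟫_ℝ ^ 2 ≤ (σ ^ s * ⟪x, g⟫_ℝ) ^ 2 := by
  unfold opRpow
  by_cases hsum : Summable fun τ : ℝ =>
      τ ^ s • (L - τ • ContinuousLinearMap.id ℝ H).ker.starProjection g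
  · have h1 := hsum.hasSum.mapL (innerSL ℝ x)
    simp only [map_smul, innerSL_apply_apply] at h1
    have h2 : HasSum (fun τ : ℝ =>
        τ ^ s • ⟪x, (L - τ • ContinuousLinearMap.id ℝ H).ker.starProjection g⟫_ℝ)
        (σ ^ s * ⟪x, g⟫_ℝ) := by
      have h3 : (L - σ • ContinuousLinearMap.id ℝ H).ker.starProjection x = x := by
        rw [Submodule.starProjection_eq_self_iff]
        simp [LinearMap.mem_ker, hx]
      have h5 : ⟪x, g⟫_ℝ
          = ⟪x, (L - σ • ContinuousLinearMap.id ℝ H).ker.starProjection g⟫_ℝ := by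
        rw [← Submodule.inner_starProjection_left_eq_right, h3]
      rw [h5, ← smul_eq_mul]
      refine hasSum_single (f := fun τ : ℝ =>
        τ ^ s • ⟪x, (L - τ • ContinuousLinearMap.id ℝ H).ker.starProjection g⟫_ℝ) σ ?_
      intro τ hτ
      have h4 : (L - τ • ContinuousLinearMap.id ℝ H).ker.starProjection x = 0 := by
        rw [Submodule.starProjection_apply_eq_zero_iff, Submodule.mem_orthogonal]
        intro u hu
        have hu' : L u = τ • u := by simpa [sub_eq_zero] using hu
        have h := hs u x
        simp only [ContinuousLinearMap.coe_coe] at h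
        rw [hu', hx, real_inner_smul_left, real_inner_smul_right] at h
        have : (τ - σ) * ⟪u, x⟫_ℝ = 0 := by linarith
        exact (mul_eq_zero.mp this).resolve_left (sub_ne_zero.mpr hτ)
      rw [← Submodule.inner_starProjection_left_eq_right, h4, inner_zero_left, smul_zero]
    rw [h1.unique h2]
  · rw [tsum_eq_zero_of_not_summable hsum, inner_zero_right, zero_pow two_ne_zero]
    exact sq_nonneg _

/-- The effective dimension `tr (L (L + λ)⁻¹)` in terms of eigenvalues. -/
theorem posTrace_mul_inverse (L : H →L[ℝ] H) (hpos : ∀ x, 0 ≤ ⟪L x, x⟫_ℝ) {ι : Type*}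
    (b : HilbertBasis ι ℝ H) {σ : ι → ℝ} (hσ : ∀ i, L (b i) = σ i • b i) (hσ0 : ∀ i, 0 ≤ σ i)
    {lam : ℝ} (hlam : 0 < lam) :
    posTrace (L * Ring.inverse (L + lam • (1 : H →L[ℝ] H)))
      = ∑' i, ENNReal.ofReal (σ i / (σ i + lam)) := by
  -- `Ring.inverse` is a true inverse only at a unit; coercivity `⟪(L + λ)x, x⟫ ≥ λ‖x‖²` provides
  -- one.
  have hunit : IsUnit (L + lam • (1 : H →L[ℝ] H)) := by
    refine ContinuousLinearMap.isUnit_of_forall_le_norm_inner_map _ (c := ⟨lam, hlam.le⟩) hlam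
      fun x => ?_
    rw [add_apply, smul_apply,
      one_apply_eq_self, inner_add_left, real_inner_smul_left,
      real_inner_self_eq_norm_sq, Real.norm_eq_abs]
    refine le_trans ?_ (le_abs_self _)
    have := hpos x
    change ‖x‖ ^ 2 * lam ≤ _
    linarith
  refine posTrace_eq_tsum_eigenvalues _ b _
    (fun i => div_nonneg (hσ0 i) (add_nonneg (hσ0 i) hlam.le)) fun i => ?_
  have hne : σ i + lam ≠ 0 := (add_pos_of_nonneg_of_pos (hσ0 i) hlam).ne'
  have h1 : (L + lam • (1 : H →L[ℝ] H)) (b i) = (σ i + lam) • b i := by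
    simp [hσ i, add_smul]
  have h2 : Ring.inverse (L + lam • (1 : H →L[ℝ] H)) (b i) = (σ i + lam)⁻¹ • b i := by
    have h3 := congrArg (fun A : H →L[ℝ] H => A (b i)) (Ring.inverse_mul_cancel _ hunit)
    simp only [mul_apply_eq_comp, one_apply_eq_self] at h3
    rw [h1, map_smul] at h3
    rw [← h3, smul_smul, inv_mul_cancel₀ hne, one_smul, h3]
  rw [mul_apply_eq_comp, h2, map_smul, hσ i, smul_smul, div_eq_inv_mul]

end Hilbert

/-! ### Bounded features -/

section Features

variable {𝒳 : Type*} [MeasurableSpace 𝒳] {V : Type*} [MeasurableSpace V]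

/-- If `{h > κ}` had positive measure, so would its square in `ν ⊗ ν`, where the product exceeds
`κ²`. The same applies to `{h < -κ}`, so a one-sided bound on products bounds `|h|`. -/
theorem ae_abs_le_of_ae_mul_le {ν : Measure 𝒳} [SFinite ν] {h : 𝒳 → ℝ} {κ : ℝ} (hκ : 0 ≤ κ)
    (H : ∀ᵐ q ∂ν.prod ν, h q.1 * h q.2 ≤ κ ^ 2) : ∀ᵐ x ∂ν, |h x| ≤ κ := by
  have key : ∀ A : Set 𝒳, (∀ x ∈ A, ∀ x' ∈ A, κ ^ 2 < h x * h x') → ν A = 0 := by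
    intro A hA
    have h1 : (ν.prod ν) (A ×ˢ A) = 0 := by
      refine measure_mono_null ?_ (ae_iff.mp H)
      rintro ⟨x, x'⟩ ⟨hx, hx'⟩
      exact not_le.mpr (hA x hx x' hx')
    rw [Measure.prod_prod] at h1
    exact mul_self_eq_zero.mp h1
  have h1 := key {x | κ < h x} fun x (hx : κ < h x) x' (hx' : κ < h x') => by nlinarith
  have h2 := key {x | h x < -κ} fun x (hx : h x < -κ) x' (hx' : h x' < -κ) => by nlinarith
  rw [ae_iff]
  refine measure_mono_null ?_ (measure_union_null h1 h2)
  intro x hx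
  rcases lt_abs.mp (not_le.mp hx) with h | h
  · exact Or.inl h
  · exact Or.inr (by simpa using neg_lt_neg h)

/-- The coefficient `⟨e, φ_v⟩` of the feature `φ_v` in `L²(ν)`. -/
noncomputable def featureCoeff (ν : Measure 𝒳) (φ : V → 𝒳 → ℝ) (e : 𝒳 → ℝ) (v : V) : ℝ :=
  ∫ x, e x * φ v x ∂ν

variable {ν : Measure 𝒳} [IsProbabilityMeasure ν] {μ : Measure V} [IsProbabilityMeasure μ]
  {φ : V → 𝒳 → ℝ} {K : 𝒳 → 𝒳 → ℝ} {κ : ℝ}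

theorem measurable_featureCoeff (hφ : Measurable (Function.uncurry φ)) {e : 𝒳 → ℝ}
    (he : Measurable e) : Measurable (featureCoeff ν φ e) := by
  have h1 : Measurable fun p : V × 𝒳 => e p.2 * φ p.1 p.2 := (he.comp measurable_snd).mul hφ
  exact h1.stronglyMeasurable.integral_prod_right.measurable

theorem ae_prod_abs_feature_le (hφ : Measurable (Function.uncurry φ))
    (hb : ∀ᵐ v ∂μ, ∀ᵐ x ∂ν, |φ v x| ≤ κ) : ∀ᵐ p ∂ν.prod μ, |φ p.2 p.1| ≤ κ := by
  have h1 : ∀ᵐ p ∂μ.prod ν, |φ p.1 p.2| ≤ κ := by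
    rw [Measure.ae_prod_iff_ae_ae]
    · exact hb
    · exact measurableSet_le hφ.abs measurable_const
  have h2 : Measure.QuasiMeasurePreserving Prod.swap (ν.prod μ) (μ.prod ν) :=
    (Measure.measurePreserving_swap (μ := ν) (ν := μ)).quasiMeasurePreserving
  exact h2.ae h1

theorem memLp_feature_of_ae_le (hφ : Measurable (Function.uncurry φ)) {v : V}
    (hv : ∀ᵐ x ∂ν, |φ v x| ≤ κ) : MemLp (φ v) 2 ν :=
  MemLp.of_bound (hφ.comp measurable_prodMk_left).aestronglyMeasurable κ hv

theorem featureCoeff_eq_inner {v : V} (hv : MemLp (φ v) 2 ν) (e : Lp ℝ 2 ν) :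
    featureCoeff ν φ e v = ⟪e, hv.toLp _⟫_ℝ := by
  rw [L2.inner_def]
  refine integral_congr_ae ?_
  filter_upwards [hv.coeFn_toLp] with x hx
  simp [hx, mul_comm]

theorem norm_toLp_feature_le (hκ : 0 ≤ κ) {v : V} (hv : ∀ᵐ x ∂ν, |φ v x| ≤ κ)
    (hm : MemLp (φ v) 2 ν) : ‖hm.toLp _‖ ≤ κ := by
  have := Lp.norm_le_of_ae_bound (f := hm.toLp _) (C := κ) hκ (by
    filter_upwards [hv, hm.coeFn_toLp] with x hx hx'
    rw [hx']
    exact hx)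
  simpa [measureUnivNNReal] using this

theorem ae_abs_featureCoeff_le (hκ : 0 ≤ κ) (hφ : Measurable (Function.uncurry φ))
    (hb : ∀ᵐ v ∂μ, ∀ᵐ x ∂ν, |φ v x| ≤ κ) (e : Lp ℝ 2 ν) :
    ∀ᵐ v ∂μ, |featureCoeff ν φ e v| ≤ κ * ‖e‖ := by
  filter_upwards [hb] with v hv
  have hm := memLp_feature_of_ae_le hφ hv
  rw [featureCoeff_eq_inner hm, mul_comm]
  refine (abs_real_inner_le_norm _ _).trans ?_
  gcongr
  exact norm_toLp_feature_le hκ hv hm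

theorem memLp_featureCoeff (hκ : 0 ≤ κ) (hφ : Measurable (Function.uncurry φ))
    (hb : ∀ᵐ v ∂μ, ∀ᵐ x ∂ν, |φ v x| ≤ κ) (e : Lp ℝ 2 ν) :
    MemLp (featureCoeff ν φ e) 2 μ :=
  MemLp.of_bound (measurable_featureCoeff hφ (Lp.stronglyMeasurable e).measurable).aestronglyMeasurable
    _ (ae_abs_featureCoeff_le hκ hφ hb e)

theorem memLp_kernel (hφ : Measurable (Function.uncurry φ))
    (hb : ∀ᵐ v ∂μ, ∀ᵐ x ∂ν, |φ v x| ≤ κ) (hKm : Measurable (Function.uncurry K))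
    (hK : ∀ x x', K x x' = ∫ v, φ v x * φ v x' ∂μ) :
    MemLp (Function.uncurry K) 2 (ν.prod ν) := by
  have h1 : ∀ᵐ x ∂ν, ∀ᵐ v ∂μ, |φ v x| ≤ κ :=
    Measure.ae_ae_of_ae_prod (ae_prod_abs_feature_le hφ hb)
  refine MemLp.of_bound hKm.aestronglyMeasurable (κ * κ) ?_
  have h2 : ∀ᵐ p ∂ν.prod ν, ∀ᵐ v ∂μ, |φ v p.1| ≤ κ :=
    Measure.quasiMeasurePreserving_fst.ae h1
  have h3 : ∀ᵐ p ∂ν.prod ν, ∀ᵐ v ∂μ, |φ v p.2| ≤ κ :=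
    Measure.quasiMeasurePreserving_snd.ae h1
  filter_upwards [h2, h3] with p hp hp'
  rw [Function.uncurry, hK]
  refine (norm_integral_le_of_norm_le_const (C := κ * κ) ?_).trans (by simp)
  filter_upwards [hp, hp'] with v hv hv'
  rw [norm_mul]
  exact mul_le_mul hv hv' (abs_nonneg _) ((abs_nonneg _).trans hv)

/-- By Fubini, `L_K` is the average of the rank-one operators `φ_v ⊗ φ_v`; this is why the random
feature step follows `L_K` on average. -/
theorem integralOperator_eq_integral_feature
    (hφ : Measurable (Function.uncurry φ))
    (hb : ∀ᵐ v ∂μ, ∀ᵐ x ∂ν, |φ v x| ≤ κ) (hKm : Measurable (Function.uncurry K))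
    (hK : ∀ x x', K x x' = ∫ v, φ v x * φ v x' ∂μ) (e : Lp ℝ 2 ν) :
    (integralOperator ν K e : 𝒳 → ℝ) =ᵐ[ν] fun x => ∫ v, φ v x * featureCoeff ν φ e v ∂μ := by
  have hprod := ae_prod_abs_feature_le hφ hb
  have h1 : ∀ᵐ x ∂ν, ∀ᵐ v ∂μ, |φ v x| ≤ κ := Measure.ae_ae_of_ae_prod hprod
  have he : Measurable (e : 𝒳 → ℝ) := (Lp.stronglyMeasurable e).measurable
  have hei : Integrable (e : 𝒳 → ℝ) ν := (Lp.memLp e).integrable (by norm_num)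
  filter_upwards [integralOperator_apply ν K (memLp_kernel hφ hb hKm hK) e, h1] with x' hx' hb'
  rw [hx']
  have hint : Integrable (fun p : 𝒳 × V => e p.1 * φ p.2 p.1 * φ p.2 x') (ν.prod μ) := by
    refine (hei.comp_fst μ).norm.const_mul (κ * κ) |>.mono' ?_ ?_
    · have m1 : Measurable fun p : 𝒳 × V => φ p.2 p.1 := hφ.comp measurable_swap
      have m2 : Measurable fun p : 𝒳 × V => φ p.2 x' :=
        hφ.comp (measurable_snd.prodMk measurable_const)
      exact (((he.comp measurable_fst).mul m1).mul m2).aestronglyMeasurable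
    · filter_upwards [hprod, Measure.quasiMeasurePreserving_snd.ae hb'] with p hp hp'
      rw [norm_mul, norm_mul, mul_assoc, mul_comm]
      exact mul_le_mul_of_nonneg_right
        (mul_le_mul hp hp' (abs_nonneg _) ((abs_nonneg _).trans hp)) (norm_nonneg _)
  calc ∫ x, e x * K x x' ∂ν = ∫ x, ∫ v, e x * φ v x * φ v x' ∂μ ∂ν := by
        refine integral_congr_ae (Filter.Eventually.of_forall fun x => ?_)
        simp only [hK, mul_assoc]
        rw [integral_const_mul]
    _ = ∫ v, ∫ x, e x * φ v x * φ v x' ∂ν ∂μ := integral_integral_swap hint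
    _ = _ := by
        refine integral_congr_ae (Filter.Eventually.of_forall fun v => ?_)
        simp only [featureCoeff]
        rw [integral_mul_const, mul_comm]

/-- Writing `A e = ⟨e, φ_v⟩` as a function of `v`, this is `L_K = A*A`; symmetry and positivity
follow. -/
theorem inner_integralOperator (hκ : 0 ≤ κ) (hφ : Measurable (Function.uncurry φ))
    (hb : ∀ᵐ v ∂μ, ∀ᵐ x ∂ν, |φ v x| ≤ κ) (hKm : Measurable (Function.uncurry K))
    (hK : ∀ x x', K x x' = ∫ v, φ v x * φ v x' ∂μ) (h e : Lp ℝ 2 ν) :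
    ⟪h, integralOperator ν K e⟫_ℝ = ∫ v, featureCoeff ν φ h v * featureCoeff ν φ e v ∂μ := by
  have hprod := ae_prod_abs_feature_le hφ hb
  have hh : Measurable (h : 𝒳 → ℝ) := (Lp.stronglyMeasurable h).measurable
  have hhi : Integrable (h : 𝒳 → ℝ) ν := (Lp.memLp h).integrable (by norm_num)
  have hc := measurable_featureCoeff (ν := ν) hφ (Lp.stronglyMeasurable e).measurable
  have hint : Integrable (fun p : 𝒳 × V => h p.1 * φ p.2 p.1 * featureCoeff ν φ e p.2)
      (ν.prod μ) := by
    refine (hhi.comp_fst μ).norm.const_mul (κ * (κ * ‖e‖)) |>.mono' ?_ ?_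
    · have m1 : Measurable fun p : 𝒳 × V => φ p.2 p.1 := hφ.comp measurable_swap
      exact (((hh.comp measurable_fst).mul m1).mul (hc.comp measurable_snd)).aestronglyMeasurable
    · filter_upwards [hprod, Measure.quasiMeasurePreserving_snd.ae
        (ae_abs_featureCoeff_le hκ hφ hb e)] with p hp hp'
      rw [norm_mul, norm_mul, mul_assoc, mul_comm]
      exact mul_le_mul_of_nonneg_right
        (mul_le_mul hp hp' (abs_nonneg _) ((abs_nonneg _).trans hp)) (norm_nonneg _)
  calc ⟪h, integralOperator ν K e⟫_ℝ
      = ∫ x, ∫ v, h x * φ v x * featureCoeff ν φ e v ∂μ ∂ν := by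
        rw [L2.inner_def]
        refine integral_congr_ae ?_
        filter_upwards [integralOperator_eq_integral_feature hφ hb hKm hK e] with x hx
        simp only [mul_assoc]
        rw [hx, integral_const_mul]
        simp [mul_comm]
    _ = ∫ v, ∫ x, h x * φ v x * featureCoeff ν φ e v ∂ν ∂μ := integral_integral_swap hint
    _ = _ := by
        refine integral_congr_ae (Filter.Eventually.of_forall fun v => ?_)
        simp only [featureCoeff]
        rw [integral_mul_const]

/-- Bessel's inequality for each `φ_v` together with `‖φ_v‖ ≤ κ`. It bounds the trace of `L_K`, and
with `s = {i}` each eigenvalue. -/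
theorem sum_integral_featureCoeff_sq_le (hκ : 0 ≤ κ) (hφ : Measurable (Function.uncurry φ))
    (hb : ∀ᵐ v ∂μ, ∀ᵐ x ∂ν, |φ v x| ≤ κ) {ι : Type*} (b : HilbertBasis ι ℝ (Lp ℝ 2 ν))
    (s : Finset ι) : ∑ i ∈ s, ∫ v, featureCoeff ν φ (b i) v ^ 2 ∂μ ≤ κ ^ 2 := by
  have hi : ∀ i ∈ s, Integrable (fun v => featureCoeff ν φ (b i) v ^ 2) μ := fun i _ =>
    (memLp_featureCoeff hκ hφ hb (b i)).integrable_sq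
  rw [← integral_finsetSum _ hi]
  calc _ ≤ ∫ _, κ ^ 2 ∂μ := by
        refine integral_mono_ae (integrable_finsetSum _ hi) (integrable_const _) ?_
        filter_upwards [hb] with v hv
        have hm := memLp_feature_of_ae_le hφ hv
        simp only [featureCoeff_eq_inner hm]
        calc _ ≤ ‖hm.toLp _‖ ^ 2 := sum_le_hasSum _ (fun _ _ => sq_nonneg _) (hasSum_inner_sq b _)
          _ ≤ κ ^ 2 := by
            gcongr
            exact norm_toLp_feature_le hκ hv hm
    _ = κ ^ 2 := by simp

theorem isSymmetric_integralOperator (hκ : 0 ≤ κ) (hφ : Measurable (Function.uncurry φ))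
    (hb : ∀ᵐ v ∂μ, ∀ᵐ x ∂ν, |φ v x| ≤ κ) (hKm : Measurable (Function.uncurry K))
    (hK : ∀ x x', K x x' = ∫ v, φ v x * φ v x' ∂μ) :
    (integralOperator ν K : Lp ℝ 2 ν →ₗ[ℝ] Lp ℝ 2 ν).IsSymmetric := by
  intro x y
  simp only [ContinuousLinearMap.coe_coe]
  rw [real_inner_comm, inner_integralOperator hκ hφ hb hKm hK,
    inner_integralOperator hκ hφ hb hKm hK]
  simp only [mul_comm]

theorem norm_sq_integralOperator_le (hκ : 0 ≤ κ) (hφ : Measurable (Function.uncurry φ))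
    (hb : ∀ᵐ v ∂μ, ∀ᵐ x ∂ν, |φ v x| ≤ κ) (hKm : Measurable (Function.uncurry K))
    (hK : ∀ x x', K x x' = ∫ v, φ v x * φ v x' ∂μ) (e : Lp ℝ 2 ν) :
    ‖integralOperator ν K e‖ ^ 2 ≤ κ ^ 2 * ∫ v, featureCoeff ν φ e v ^ 2 ∂μ := by
  set n := ‖integralOperator ν K e‖ ^ 2 with hn
  set h := integralOperator ν K e with hh
  have hch := memLp_featureCoeff hκ hφ hb h
  have hce := memLp_featureCoeff hκ hφ hb e
  have h1 : n = ∫ v, featureCoeff ν φ h v * featureCoeff ν φ e v ∂μ := by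
    rw [hn, ← real_inner_self_eq_norm_sq, ← inner_integralOperator hκ hφ hb hKm hK]
  have h2 : ∫ v, featureCoeff ν φ h v ^ 2 ∂μ ≤ κ ^ 2 * n := by
    calc _ ≤ ∫ _, κ ^ 2 * n ∂μ := by
          refine integral_mono_ae hch.integrable_sq (integrable_const _) ?_
          filter_upwards [ae_abs_featureCoeff_le hκ hφ hb h] with v hv
          rw [← sq_abs, hn, ← mul_pow]
          gcongr
      _ = _ := by simp
  -- With `h = L_K e` and `n = ‖h‖² = ⟨Ah, Ae⟩`, this is `2κ²⟨Ah, Ae⟩ ≤ ‖Ah‖² + κ⁴‖Ae‖²`. Since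
  -- `‖Ah‖² ≤ κ²n`, half of the left side is absorbed; cancelling `κ²` requires treating `κ = 0`
  -- apart.
  have h3 : ∫ v, 2 * (featureCoeff ν φ h v * featureCoeff ν φ e v) * κ ^ 2 ∂μ
      ≤ ∫ v, featureCoeff ν φ h v ^ 2 + κ ^ 4 * featureCoeff ν φ e v ^ 2 ∂μ := by
    refine integral_mono (((hch.integrable_mul hce).const_mul 2).mul_const _)
      (hch.integrable_sq.add (hce.integrable_sq.const_mul _)) fun v => ?_
    simp only
    nlinarith [sq_nonneg (featureCoeff ν φ h v - κ ^ 2 * featureCoeff ν φ e v)]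
  rw [integral_mul_const, integral_const_mul, ← h1,
    integral_add hch.integrable_sq (hce.integrable_sq.const_mul _), integral_const_mul] at h3
  rcases hκ.eq_or_lt with h0 | h0
  · subst h0
    have h4 : ∫ v, featureCoeff ν φ h v ^ 2 ∂μ = 0 :=
      le_antisymm (by simpa using h2) (integral_nonneg fun _ => sq_nonneg _)
    have h5 : (fun v => featureCoeff ν φ h v ^ 2) =ᵐ[μ] 0 :=
      (integral_eq_zero_iff_of_nonneg (fun _ => sq_nonneg _) hch.integrable_sq).mp h4
    have h6 : n = 0 := by
      rw [h1]
      refine integral_eq_zero_of_ae ?_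
      filter_upwards [h5] with v hv
      simp only [Pi.zero_apply] at hv ⊢
      rw [pow_eq_zero_iff two_ne_zero] at hv
      rw [hv, zero_mul]
    rw [h6]
    simp
  · have hk : 0 < κ ^ 2 := by positivity
    have : κ ^ 2 * n ≤ κ ^ 2 * (κ ^ 2 * ∫ v, featureCoeff ν φ e v ^ 2 ∂μ) := by nlinarith
    exact le_of_mul_le_mul_left this hk

/-- The integral operator of a bounded feature model has a Hilbert basis of eigenvectors, with
eigenvalues `σᵢ = ∫ ⟨bᵢ, φ_v⟩² dμ ∈ [0, κ²]`. -/
theorem exists_eigenbasis_integralOperator (hκ : 0 ≤ κ) (hφ : Measurable (Function.uncurry φ))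
    (hb : ∀ᵐ v ∂μ, ∀ᵐ x ∂ν, |φ v x| ≤ κ) (hKm : Measurable (Function.uncurry K))
    (hK : ∀ x x', K x x' = ∫ v, φ v x * φ v x' ∂μ) :
    ∃ (w : Set (Lp ℝ 2 ν)) (b : HilbertBasis w ℝ (Lp ℝ 2 ν)) (σ : w → ℝ),
      (∀ i, integralOperator ν K (b i) = σ i • b i) ∧
      (∀ i, σ i = ∫ v, featureCoeff ν φ (b i) v ^ 2 ∂μ) ∧ (∀ i, 0 ≤ σ i) ∧ ∀ i, σ i ≤ κ ^ 2 := by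
  obtain ⟨w₀, b₀, -⟩ := exists_hilbertBasis ℝ (Lp ℝ 2 ν)
  have hcomp : IsCompactOperator (integralOperator ν K) := by
    refine isCompactOperator_of_summable_norm_sq b₀ _ ?_
    refine Summable.of_nonneg_of_le (fun _ => sq_nonneg _)
      (fun i => norm_sq_integralOperator_le hκ hφ hb hKm hK (b₀ i)) (Summable.mul_left _ ?_)
    exact summable_of_sum_le (fun i => integral_nonneg fun _ => sq_nonneg _)
      (sum_integral_featureCoeff_sq_le hκ hφ hb b₀)
  obtain ⟨w, b, σ, hσ⟩ := exists_hilbertBasis_eigenvectors _ hcomp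
    (isSymmetric_integralOperator hκ hφ hb hKm hK)
  have h1 : ∀ i, σ i = ∫ v, featureCoeff ν φ (b i) v ^ 2 ∂μ := by
    intro i
    have := inner_integralOperator hκ hφ hb hKm hK (b i) (b i)
    rw [hσ, real_inner_smul_right, real_inner_self_eq_norm_sq, b.orthonormal.1 i] at this
    simpa [sq] using this
  refine ⟨w, b, σ, hσ, h1, fun i => ?_, fun i => ?_⟩
  · rw [h1]
    exact integral_nonneg fun _ => sq_nonneg _
  · rw [h1]
    simpa using sum_integral_featureCoeff_sq_le hκ hφ hb b {i}

end Features

/-! ### One step of the algorithm -/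

section OneStep

variable {𝒳 : Type*} [MeasurableSpace 𝒳] {V : Type*} [MeasurableSpace V]
  {ρ : Measure (𝒳 × ℝ)} [IsProbabilityMeasure ρ] {μ : Measure V} [IsProbabilityMeasure μ]
  {φ : V → 𝒳 → ℝ} {K : 𝒳 → 𝒳 → ℝ} {κ : ℝ}

theorem integrable_mul_of_memLp_two {α : Type*} [MeasurableSpace α] {m : Measure α} {f g : α → ℝ}
    (hf : MemLp f 2 m) (hg : MemLp g 2 m) : Integrable (fun x => f x * g x) m :=
  hf.integrable_mul hg

theorem measurePreserving_fst_marginal : MeasurePreserving Prod.fst ρ ρ.fst :=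
  ⟨measurable_fst, rfl⟩

theorem integral_fst_marginal {h : 𝒳 → ℝ} (hh : AEStronglyMeasurable h ρ.fst) :
    ∫ x, h x ∂ρ.fst = ∫ z, h z.1 ∂ρ :=
  integral_map measurable_fst.aemeasurable hh

theorem memLp_snd_of_integrable_sq (hy : Integrable (fun z : 𝒳 × ℝ => z.2 ^ 2) ρ) :
    MemLp (fun z : 𝒳 × ℝ => z.2) 2 ρ :=
  (memLp_two_iff_integrable_sq measurable_snd.aestronglyMeasurable).mpr hy

theorem integral_mul_regressionFunction (hy : Integrable (fun z : 𝒳 × ℝ => z.2 ^ 2) ρ)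
    {h : 𝒳 → ℝ} (hh : MemLp h 2 ρ.fst) :
    ∫ z, z.2 * h z.1 ∂ρ = ∫ x, regressionFunction ρ x * h x ∂ρ.fst := by
  have hint : Integrable (fun z : 𝒳 × ℝ => z.2 * h z.1) ρ :=
    (memLp_snd_of_integrable_sq hy).integrable_mul
      (hh.comp_measurePreserving measurePreserving_fst_marginal)
  rw [← Measure.integral_condKernel hint]
  refine integral_congr_ae (Filter.Eventually.of_forall fun x => ?_)
  simp only [regressionFunction]
  rw [integral_mul_const]

/-- The cross term vanishes because `f - f_ρ` depends on `x` alone and `f_ρ` is the conditional mean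
of `y`. -/
theorem expectedRisk_eq_add (hy : Integrable (fun z : 𝒳 × ℝ => z.2 ^ 2) ρ)
    (hρ : MemLp (regressionFunction ρ) 2 ρ.fst) {f : 𝒳 → ℝ} (hf : MemLp f 2 ρ.fst) :
    expectedRisk ρ f
      = ∫ x, (f x - regressionFunction ρ x) ^ 2 ∂ρ.fst + expectedRisk ρ (regressionFunction ρ) := by
  set r := regressionFunction ρ with hr
  have hd : MemLp (fun x => f x - r x) 2 ρ.fst := hf.sub hρ
  have hd' : MemLp (fun z : 𝒳 × ℝ => f z.1 - r z.1) 2 ρ :=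
    hd.comp_measurePreserving measurePreserving_fst_marginal
  have hr' : MemLp (fun z : 𝒳 × ℝ => r z.1) 2 ρ :=
    hρ.comp_measurePreserving measurePreserving_fst_marginal
  have hy' := memLp_snd_of_integrable_sq hy
  have hry : MemLp (fun z : 𝒳 × ℝ => r z.1 - z.2) 2 ρ := hr'.sub hy'
  have hcross : ∫ z, (f z.1 - r z.1) * (r z.1 - z.2) ∂ρ = 0 := by
    have h1 := integral_mul_regressionFunction hy hd
    have h2 : ∫ x, r x * (f x - r x) ∂ρ.fst = ∫ z, r z.1 * (f z.1 - r z.1) ∂ρ :=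
      integral_fst_marginal (hρ.integrable_mul hd).aestronglyMeasurable
    have h3 : ∀ z : 𝒳 × ℝ, (f z.1 - r z.1) * (r z.1 - z.2)
        = r z.1 * (f z.1 - r z.1) - z.2 * (f z.1 - r z.1) := fun z => by ring
    simp_rw [h3]
    rw [integral_sub (integrable_mul_of_memLp_two hr' hd')
      (integrable_mul_of_memLp_two hy' hd'), h1, ← hr, h2, sub_self]
  have h4 : ∀ z : 𝒳 × ℝ, (f z.1 - z.2) ^ 2
      = (f z.1 - r z.1) ^ 2 + 2 * ((f z.1 - r z.1) * (r z.1 - z.2)) + (r z.1 - z.2) ^ 2 :=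
    fun z => by ring
  simp only [expectedRisk]
  simp_rw [h4]
  have i1 : Integrable (fun z : 𝒳 × ℝ => (f z.1 - r z.1) ^ 2) ρ := hd'.integrable_sq
  have i2 : Integrable (fun z : 𝒳 × ℝ => 2 * ((f z.1 - r z.1) * (r z.1 - z.2))) ρ :=
    (hd'.integrable_mul hry).const_mul 2
  have i3 : Integrable (fun z : 𝒳 × ℝ => (r z.1 - z.2) ^ 2) ρ := hry.integrable_sq
  have i12 : Integrable (fun z : 𝒳 × ℝ => (f z.1 - r z.1) ^ 2
      + 2 * ((f z.1 - r z.1) * (r z.1 - z.2))) ρ := i1.add i2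
  rw [integral_add i12 i3, integral_add i1 i2, integral_const_mul, hcross, mul_zero,
    add_zero, integral_fst_marginal hd.integrable_sq.aestronglyMeasurable]

/-- The one-step inequality for the coordinate of the error along an eigenvector `e` of `L_K`. -/
theorem lintegral_coordinate_step_le (hκ : 0 ≤ κ)
    (hy : Integrable (fun z : 𝒳 × ℝ => z.2 ^ 2) ρ) (hφ : Measurable (Function.uncurry φ))
    (hb : ∀ᵐ v ∂μ, ∀ᵐ x ∂ρ.fst, |φ v x| ≤ κ) (hKm : Measurable (Function.uncurry K))
    (hK : ∀ x x', K x x' = ∫ v, φ v x * φ v x' ∂μ)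
    (hρ : MemLp (regressionFunction ρ) 2 ρ.fst) {e : Lp ℝ 2 ρ.fst} {σ S : ℝ}
    (he : integralOperator ρ.fst K e = σ • e)
    (hσ : σ = ∫ v, featureCoeff ρ.fst φ e v ^ 2 ∂μ)
    (hS : expectedRisk ρ (regressionFunction ρ) ≤ S) {f : 𝒳 → ℝ} (hfm : Measurable f)
    (hf : MemLp f 2 ρ.fst) (η : ℝ) :
    ∫⁻ p, ENNReal.ofReal ((∫ x, e x * ((f x - η * (f p.1.1 - p.1.2) * φ p.2 p.1.1 * φ p.2 x)
        - regressionFunction ρ x) ∂ρ.fst) ^ 2) ∂(ρ.prod μ)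
      ≤ ENNReal.ofReal ((1 - η * σ) ^ 2) *
          ENNReal.ofReal ((∫ x, e x * (f x - regressionFunction ρ x) ∂ρ.fst) ^ 2)
        + ENNReal.ofReal (κ ^ 2 * η ^ 2 * σ) *
          (ENNReal.ofReal (∫ x, (f x - regressionFunction ρ x) ^ 2 ∂ρ.fst) + ENNReal.ofReal S) := by
  set r := regressionFunction ρ with hr
  set a := ∫ x, e x * (f x - r x) ∂ρ.fst with ha
  set c := featureCoeff ρ.fst φ e with hc
  set Y : (𝒳 × ℝ) × V → ℝ := fun p => (f p.1.1 - p.1.2) * φ p.2 p.1.1 * c p.2 with hY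
  have hσ0 : 0 ≤ σ := hσ ▸ integral_nonneg fun _ => sq_nonneg _
  have hem : Measurable (e : 𝒳 → ℝ) := (Lp.stronglyMeasurable e).measurable
  have he2 : MemLp (e : 𝒳 → ℝ) 2 ρ.fst := Lp.memLp e
  have hd : MemLp (fun x => f x - r x) 2 ρ.fst := hf.sub hρ
  have hfy : MemLp (fun z : 𝒳 × ℝ => f z.1 - z.2) 2 ρ :=
    (hf.comp_measurePreserving measurePreserving_fst_marginal).sub (memLp_snd_of_integrable_sq hy)
  have hcm : Measurable c := measurable_featureCoeff hφ hem
  have hc2 : MemLp c 2 μ := memLp_featureCoeff hκ hφ hb e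
  have hcb : ∀ᵐ p ∂ρ.prod μ, |c p.2| ≤ κ * ‖e‖ :=
    Measure.quasiMeasurePreserving_snd.ae (ae_abs_featureCoeff_le hκ hφ hb e)
  have hq : Measure.QuasiMeasurePreserving (fun p : (𝒳 × ℝ) × V => (p.1.1, p.2)) (ρ.prod μ)
      (ρ.fst.prod μ) :=
    (measurePreserving_fst_marginal.prod (MeasurePreserving.id μ)).quasiMeasurePreserving
  have hφb : ∀ᵐ p ∂ρ.prod μ, |φ p.2 p.1.1| ≤ κ := hq.ae (ae_prod_abs_feature_le hφ hb)
  have hφm : Measurable fun p : (𝒳 × ℝ) × V => φ p.2 p.1.1 :=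
    hφ.comp (measurable_snd.prodMk (measurable_fst.comp measurable_fst))
  have hfym : Measurable fun p : (𝒳 × ℝ) × V => f p.1.1 - p.1.2 :=
    (hfm.comp (measurable_fst.comp measurable_fst)).sub (measurable_snd.comp measurable_fst)
  have hYm : Measurable Y := (hfym.mul hφm).mul (hcm.comp measurable_snd)
  have hY2 : MemLp Y 2 (ρ.prod μ) := by
    refine MemLp.of_le_mul (c := κ * (κ * ‖e‖)) (hfy.comp_fst μ) hYm.aestronglyMeasurable ?_
    filter_upwards [hφb, hcb] with p h1 h2
    simp only [hY, norm_mul]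
    rw [mul_assoc, mul_comm]
    exact mul_le_mul_of_nonneg_right
      (mul_le_mul h1 h2 (abs_nonneg _) ((abs_nonneg _).trans h1)) (norm_nonneg _)
  have hY1 : Integrable Y (ρ.prod μ) := hY2.integrable (by norm_num)
  -- Integrating over `v` first produces `L_K e = σ e`; integrating over `y` then replaces it by
  -- `f_ρ`.
  have hEY : ∫ p, Y p ∂(ρ.prod μ) = σ * a := by
    rw [integral_prod _ hY1]
    have h1 : ∀ᵐ x ∂ρ.fst, ∫ v, φ v x * c v ∂μ = σ * e x := by
      filter_upwards [integralOperator_eq_integral_feature hφ hb hKm hK e,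
        Lp.coeFn_smul σ e] with x h1 h2
      rw [← h1, he, h2, Pi.smul_apply, smul_eq_mul]
    have h2 : ∀ᵐ z ∂ρ, ∫ v, Y (z, v) ∂μ = σ * (f z.1 * e z.1 - z.2 * e z.1) := by
      filter_upwards [measurePreserving_fst_marginal.quasiMeasurePreserving.ae h1] with z hz
      simp only [hY, mul_assoc]
      rw [integral_const_mul, hz]
      ring
    rw [integral_congr_ae h2, integral_const_mul]
    have he' : MemLp (fun z : 𝒳 × ℝ => e z.1) 2 ρ :=
      he2.comp_measurePreserving measurePreserving_fst_marginal
    have hf' : MemLp (fun z : 𝒳 × ℝ => f z.1) 2 ρ :=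
      hf.comp_measurePreserving measurePreserving_fst_marginal
    rw [integral_sub (integrable_mul_of_memLp_two hf' he')
      (integrable_mul_of_memLp_two (memLp_snd_of_integrable_sq hy) he'),
      integral_mul_regressionFunction hy he2, ← integral_fst_marginal (h := fun x => f x * e x)
      (hf.integrable_mul he2).aestronglyMeasurable, ← integral_sub
      (integrable_mul_of_memLp_two hf he2) (integrable_mul_of_memLp_two hρ he2), ha]
    congr 1
    refine integral_congr_ae (Filter.Eventually.of_forall fun x => ?_)
    simp only
    ring
  -- Bounding `φ_v(x)²` by `κ²` decouples `z` from `v`; the remaining factor `⟨e, φ_v⟩²` has mean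
  -- `σ`.
  have hEY2 : ∫ p, Y p ^ 2 ∂(ρ.prod μ) ≤ κ ^ 2 * σ * expectedRisk ρ f := by
    calc ∫ p, Y p ^ 2 ∂(ρ.prod μ)
        ≤ ∫ p, κ ^ 2 * ((f p.1.1 - p.1.2) ^ 2 * c p.2 ^ 2) ∂(ρ.prod μ) := by
          refine integral_mono_ae hY2.integrable_sq
            ((hfy.integrable_sq.mul_prod hc2.integrable_sq).const_mul _) ?_
          filter_upwards [hφb] with p hp
          have h1 : φ p.2 p.1.1 ^ 2 ≤ κ ^ 2 := by
            rw [← sq_abs]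
            gcongr
          have h2 : 0 ≤ (f p.1.1 - p.1.2) ^ 2 * c p.2 ^ 2 := by positivity
          simp only [hY]
          nlinarith [mul_le_mul_of_nonneg_right h1 h2]
      _ = κ ^ 2 * σ * expectedRisk ρ f := by
          rw [integral_const_mul, integral_prod_mul (fun z : 𝒳 × ℝ => (f z.1 - z.2) ^ 2)
            (fun v => c v ^ 2), ← hσ, expectedRisk]
          ring
  have hcoord : ∀ᵐ p ∂ρ.prod μ,
      (∫ x, e x * ((f x - η * (f p.1.1 - p.1.2) * φ p.2 p.1.1 * φ p.2 x) - r x) ∂ρ.fst)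
        = a - η * Y p := by
    filter_upwards [Measure.quasiMeasurePreserving_snd.ae hb] with p hp
    have hm := memLp_feature_of_ae_le hφ hp
    have h1 : ∀ x, e x * ((f x - η * (f p.1.1 - p.1.2) * φ p.2 p.1.1 * φ p.2 x) - r x)
        = e x * (f x - r x) - (η * (f p.1.1 - p.1.2) * φ p.2 p.1.1) * (e x * φ p.2 x) :=
      fun x => by ring
    simp_rw [h1]
    rw [integral_sub (integrable_mul_of_memLp_two he2 hd)
      ((integrable_mul_of_memLp_two he2 hm).const_mul _),
      integral_const_mul]
    simp only [hY, hc, featureCoeff]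
    ring
  have hreal : ∫ p, (a - η * Y p) ^ 2 ∂(ρ.prod μ)
      ≤ (1 - η * σ) ^ 2 * a ^ 2
        + κ ^ 2 * η ^ 2 * σ * (∫ x, (f x - r x) ^ 2 ∂ρ.fst + S) := by
    have h1 : ∀ p, (a - η * Y p) ^ 2 = a ^ 2 - 2 * a * η * Y p + η ^ 2 * Y p ^ 2 :=
      fun p => by ring
    simp_rw [h1]
    have i1 : Integrable (fun p => a ^ 2 - 2 * a * η * Y p) (ρ.prod μ) :=
      (integrable_const _).sub (hY1.const_mul _)
    rw [integral_add i1 (hY2.integrable_sq.const_mul _), integral_sub (integrable_const _) (hY1.const_mul _),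
      integral_const_mul, integral_const_mul, hEY, integral_const, probReal_univ, one_smul]
    have h2 : expectedRisk ρ f ≤ ∫ x, (f x - r x) ^ 2 ∂ρ.fst + S := by
      rw [expectedRisk_eq_add hy hρ hf]
      gcongr
    have h3 : η ^ 2 * ∫ p, Y p ^ 2 ∂(ρ.prod μ)
        ≤ η ^ 2 * (κ ^ 2 * σ * (∫ x, (f x - r x) ^ 2 ∂ρ.fst + S)) := by
      gcongr
      exact hEY2.trans (mul_le_mul_of_nonneg_left h2 (by positivity))
    -- `a² - 2ησa² = (1 - ησ)²a² - (ησa)²`, and the last square is dropped.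
    nlinarith [sq_nonneg (η * σ * a)]
  have hS0 : 0 ≤ S := le_trans (integral_nonneg fun _ => sq_nonneg _) hS
  have hd0 : 0 ≤ ∫ x, (f x - r x) ^ 2 ∂ρ.fst := integral_nonneg fun _ => sq_nonneg _
  calc _ = ∫⁻ p, ENNReal.ofReal ((a - η * Y p) ^ 2) ∂(ρ.prod μ) := by
        refine lintegral_congr_ae ?_
        filter_upwards [hcoord] with p hp
        rw [hp]
    _ = ENNReal.ofReal (∫ p, (a - η * Y p) ^ 2 ∂(ρ.prod μ)) := by
        refine (ofReal_integral_eq_lintegral_ofReal ?_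
          (Filter.Eventually.of_forall fun _ => sq_nonneg _)).symm
        exact ((memLp_const a).sub (hY2.const_mul η)).integrable_sq
    _ ≤ _ := by
        refine (ENNReal.ofReal_le_ofReal hreal).trans (le_of_eq ?_)
        rw [ENNReal.ofReal_add (by positivity) (by positivity),
          ENNReal.ofReal_mul (sq_nonneg (1 - η * σ)), ENNReal.ofReal_mul (by positivity),
          ENNReal.ofReal_add hd0 hS0]

end OneStep

/-! ### The iterates as functions of the sample -/

section Iterates

variable {𝒳 : Type*} [MeasurableSpace 𝒳] {V : Type*} [MeasurableSpace V]
  {φ : V → 𝒳 → ℝ}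

theorem measurable_dsIterate (hφ : Measurable (Function.uncurry φ)) (η : ℕ → ℝ) (lam : ℝ) (t : ℕ) :
    Measurable fun p : (ℕ → (𝒳 × ℝ) × V) × 𝒳 => dsIterate η lam φ p.1 t p.2 := by
  induction t with
  | zero => exact measurable_const
  | succ t ih =>
    have hw : Measurable fun p : (ℕ → (𝒳 × ℝ) × V) × 𝒳 => p.1 (t + 1) :=
      (measurable_pi_apply (t + 1)).comp measurable_fst
    have h1 : Measurable fun p : (ℕ → (𝒳 × ℝ) × V) × 𝒳 =>
        dsIterate η lam φ p.1 t (p.1 (t + 1)).1.1 :=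
      ih.comp (measurable_fst.prodMk hw.fst.fst)
    have h2 : Measurable fun p : (ℕ → (𝒳 × ℝ) × V) × 𝒳 => φ (p.1 (t + 1)).2 (p.1 (t + 1)).1.1 :=
      hφ.comp (hw.snd.prodMk hw.fst.fst)
    have h3 : Measurable fun p : (ℕ → (𝒳 × ℝ) × V) × 𝒳 => φ (p.1 (t + 1)).2 p.2 :=
      hφ.comp (hw.snd.prodMk measurable_snd)
    exact (ih.const_mul _).sub ((((h1.sub hw.fst.snd).const_mul _).mul h2).mul h3)

theorem measurable_dsIterate_apply (hφ : Measurable (Function.uncurry φ)) (η : ℕ → ℝ) (lam : ℝ)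
    (W : ℕ → (𝒳 × ℝ) × V) (t : ℕ) : Measurable (dsIterate η lam φ W t) :=
  (measurable_dsIterate hφ η lam t).comp measurable_prodMk_left

theorem dsIterate_congr (η : ℕ → ℝ) (lam : ℝ) {W W' : ℕ → (𝒳 × ℝ) × V} {t : ℕ}
    (h : ∀ k, 1 ≤ k → k ≤ t → W k = W' k) : dsIterate η lam φ W t = dsIterate η lam φ W' t := by
  induction t with
  | zero => rfl
  | succ t ih =>
    funext x
    simp only [dsIterate]
    rw [ih fun k h1 h2 => h k h1 (by omega), h (t + 1) (by omega) le_rfl]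

theorem memLp_dsIterate {ν : Measure 𝒳} (η : ℕ → ℝ) (lam : ℝ)
    {W : ℕ → (𝒳 × ℝ) × V} {t : ℕ} (h : ∀ k, 1 ≤ k → k ≤ t → MemLp (φ (W k).2) 2 ν) :
    MemLp (dsIterate η lam φ W t) 2 ν := by
  induction t with
  | zero => exact MemLp.zero
  | succ t ih =>
    exact ((ih fun k h1 h2 => h k h1 (by omega)).const_mul _).sub
      ((h (t + 1) (by omega) le_rfl).const_mul _)

theorem dsIterate_succ_zero (η : ℕ → ℝ) (W : ℕ → (𝒳 × ℝ) × V) (t : ℕ) (x : 𝒳) :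
    dsIterate η 0 φ W (t + 1) x = dsIterate η 0 φ W t x
      - η (t + 1) * (dsIterate η 0 φ W t (W (t + 1)).1.1 - (W (t + 1)).1.2)
        * φ (W (t + 1)).2 (W (t + 1)).1.1 * φ (W (t + 1)).2 x := by
  simp [dsIterate]

theorem measurable_regressionFunction (ρ : Measure (𝒳 × ℝ)) [IsFiniteMeasure ρ] :
    Measurable (regressionFunction ρ) := by
  have : StronglyMeasurable fun x => ∫ y, (fun p : 𝒳 × ℝ => p.2) (x, y) ∂ρ.condKernel x :=
    measurable_snd.stronglyMeasurable.integral_kernel_prod_right'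
  exact this.measurable

end Iterates

/-! ### Independence of the past -/

section Past

variable {Z Ω : Type*} [MeasurableSpace Z] [MeasurableSpace Ω]

/-- The sample up to time `t`, continued by a constant. -/
def past (z₀ : Z) (w : ℕ → Ω → Z) (t : ℕ) (ω : Ω) (k : ℕ) : Z :=
  if 1 ≤ k ∧ k ≤ t then w k ω else z₀

theorem past_of_le {z₀ : Z} {w : ℕ → Ω → Z} {t k : ℕ} (h1 : 1 ≤ k) (h2 : k ≤ t) (ω : Ω) :
    past z₀ w t ω k = w k ω := if_pos ⟨h1, h2⟩

theorem aemeasurable_past {P : Measure Ω} {z₀ : Z} {w : ℕ → Ω → Z} {t T : ℕ} (ht : t ≤ T)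
    (hw : ∀ k ∈ Set.Icc 1 T, AEMeasurable (w k) P) : AEMeasurable (past z₀ w t) P := by
  refine aemeasurable_pi_iff.mpr fun k => ?_
  by_cases h : 1 ≤ k ∧ k ≤ t
  · simp only [past, if_pos h]
    exact hw k ⟨h.1, h.2.trans ht⟩
  · simp only [past, if_neg h]
    exact aemeasurable_const

/-- The padded past is a measurable function of the block of indices `1, …, t`, which is disjoint
from `{t + 1}`. Padding discards the indices about which nothing is assumed. -/
theorem indepFun_past {P : Measure Ω} {z₀ : Z} {w : ℕ → Ω → Z} {t T : ℕ} (ht : t + 1 ≤ T)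
    (hw : ∀ k ∈ Set.Icc 1 T, AEMeasurable (w k) P)
    (hind : iIndepFun (fun k : Set.Icc 1 T => w k) P) :
    IndepFun (past z₀ w t) (w (t + 1)) P := by
  classical
  have hlast : t + 1 ∈ Set.Icc 1 T := ⟨by omega, ht⟩
  let A : Finset (Set.Icc 1 T) := Finset.univ.filter fun k => (k : ℕ) ≤ t
  let B : Finset (Set.Icc 1 T) := {⟨t + 1, hlast⟩}
  have hAB : Disjoint A B := by
    rw [Finset.disjoint_singleton_right]
    simp [A]
  have h1 := hind.indepFun_finset₀ A B hAB fun k => hw k k.2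
  let f : (A → Z) → ℕ → Z := fun a k =>
    if h : 1 ≤ k ∧ k ≤ t then
      a ⟨⟨k, h.1, h.2.trans (by omega)⟩, Finset.mem_filter.mpr ⟨Finset.mem_univ _, h.2⟩⟩
    else z₀
  let g : (B → Z) → Z := fun b => b ⟨⟨t + 1, hlast⟩, Finset.mem_singleton_self _⟩
  have hf : Measurable f := by
    refine measurable_pi_iff.mpr fun k => ?_
    by_cases h : 1 ≤ k ∧ k ≤ t
    · simp only [f, dif_pos h]
      exact measurable_pi_apply _
    · simp only [f, dif_neg h]
      exact measurable_const
  have hg : Measurable g := measurable_pi_apply _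
  have h2 := h1.comp hf hg
  have e1 : (f ∘ fun ω (i : A) => w i ω) = past z₀ w t := by
    funext ω k
    by_cases h : 1 ≤ k ∧ k ≤ t
    · simp [f, past, h]
    · simp [f, past, h]
  rw [e1] at h2
  exact h2

/-- Conditioning on the past: the joint law is a product, so the new sample is integrated with the
past frozen. -/
theorem lintegral_past_prod {P : Measure Ω} [IsProbabilityMeasure P] {π : Measure Z}
    [IsProbabilityMeasure π] {z₀ : Z} {w : ℕ → Ω → Z} {t T : ℕ} (ht : t + 1 ≤ T)
    (hw : ∀ k ∈ Set.Icc 1 T, HasLaw (w k) π P)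
    (hind : iIndepFun (fun k : Set.Icc 1 T => w k) P)
    {F : (ℕ → Z) × Z → ℝ≥0∞} (hF : Measurable F) :
    ∫⁻ ω, F (past z₀ w t ω, w (t + 1) ω) ∂P
      = ∫⁻ ω, ∫⁻ z, F (past z₀ w t ω, z) ∂π ∂P := by
  have hwm : ∀ k ∈ Set.Icc 1 T, AEMeasurable (w k) P := fun k hk => (hw k hk).aemeasurable
  have hp := aemeasurable_past (z₀ := z₀) (t := t) (by omega) hwm
  have hl : t + 1 ∈ Set.Icc 1 T := ⟨by omega, ht⟩
  have h1 := (indepFun_iff_map_prod_eq_prod_map_map hp (hwm _ hl)).mp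
    (indepFun_past (z₀ := z₀) ht hwm hind)
  rw [(hw _ hl).map_eq] at h1
  rw [← lintegral_map' (f := F) (g := fun ω => (past z₀ w t ω, w (t + 1) ω)) hF.aemeasurable
    (hp.prodMk (hwm _ hl)), h1, lintegral_prod _ hF.aemeasurable]
  exact lintegral_map' (Measurable.lintegral_prod_right' hF).aemeasurable hp

end Past

/-! ### Coordinates of the expected excess risk -/

section Excess

variable {𝒳 : Type*} [MeasurableSpace 𝒳] {V : Type*} [MeasurableSpace V]
  {Ω : Type*} [MeasurableSpace Ω] {ρ : Measure (𝒳 × ℝ)} [IsProbabilityMeasure ρ]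
  {μ : Measure V} [IsProbabilityMeasure μ] {P : Measure Ω} [IsProbabilityMeasure P]
  {φ : V → 𝒳 → ℝ} {K : 𝒳 → 𝒳 → ℝ} {κ : ℝ} {T : ℕ} {w : ℕ → Ω → (𝒳 × ℝ) × V} {η : ℕ → ℝ}

/-- The coordinate along `e` of the error `f_{t+1} - f_ρ`. -/
noncomputable def errorCoord (ρ : Measure (𝒳 × ℝ)) [IsFiniteMeasure ρ] (φ : V → 𝒳 → ℝ) (η : ℕ → ℝ) (e : 𝒳 → ℝ)
    (t : ℕ) (W : ℕ → (𝒳 × ℝ) × V) : ℝ :=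
  ∫ x, e x * (dsIterate η 0 φ W t x - regressionFunction ρ x) ∂ρ.fst

theorem measurable_errorCoord (hφ : Measurable (Function.uncurry φ)) {e : 𝒳 → ℝ}
    (he : Measurable e) (t : ℕ) : Measurable (errorCoord ρ φ η e t) := by
  have h1 : Measurable fun p : (ℕ → (𝒳 × ℝ) × V) × 𝒳 =>
      e p.2 * (dsIterate η 0 φ p.1 t p.2 - regressionFunction ρ p.2) :=
    (he.comp measurable_snd).mul ((measurable_dsIterate hφ η 0 t).sub
      ((measurable_regressionFunction ρ).comp measurable_snd))
  exact h1.stronglyMeasurable.integral_prod_right.measurable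

theorem errorCoord_past (z₀ : (𝒳 × ℝ) × V) (e : 𝒳 → ℝ) (t : ℕ) (ω : Ω) :
    errorCoord ρ φ η e t (past z₀ w t ω) = errorCoord ρ φ η e t fun k => w k ω := by
  unfold errorCoord
  rw [dsIterate_congr η 0 fun k h1 h2 => past_of_le h1 h2 ω]

theorem ae_memLp_feature_sample (hφ : Measurable (Function.uncurry φ))
    (hb : ∀ᵐ v ∂μ, ∀ᵐ x ∂ρ.fst, |φ v x| ≤ κ)
    (hw : ∀ k ∈ Set.Icc 1 T, HasLaw (w k) (ρ.prod μ) P) :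
    ∀ᵐ ω ∂P, ∀ k ∈ Set.Icc 1 T, MemLp (φ (w k ω).2) 2 ρ.fst := by
  rw [ae_all_iff]
  intro k
  by_cases hk : k ∈ Set.Icc 1 T
  · have h1 : ∀ᵐ p ∂ρ.prod μ, MemLp (φ p.2) 2 ρ.fst := by
      filter_upwards [Measure.quasiMeasurePreserving_snd.ae hb] with p hp
      exact memLp_feature_of_ae_le hφ hp
    rw [← (hw k hk).map_eq] at h1
    filter_upwards [ae_of_ae_map (hw k hk).aemeasurable h1] with ω hω _
    exact hω
  · exact Filter.Eventually.of_forall fun ω h => absurd h hk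

theorem ae_memLp_dsIterate (hφ : Measurable (Function.uncurry φ))
    (hb : ∀ᵐ v ∂μ, ∀ᵐ x ∂ρ.fst, |φ v x| ≤ κ)
    (hw : ∀ k ∈ Set.Icc 1 T, HasLaw (w k) (ρ.prod μ) P) {t : ℕ} (ht : t ≤ T) :
    ∀ᵐ ω ∂P, MemLp (dsIterate η 0 φ (fun k => w k ω) t) 2 ρ.fst := by
  filter_upwards [ae_memLp_feature_sample hφ hb hw] with ω hω
  exact memLp_dsIterate η 0 fun k h1 h2 => hω k ⟨h1, h2.trans ht⟩

theorem integral_sq_eq_norm_sq {h : 𝒳 → ℝ} {ν : Measure 𝒳} (hh : MemLp h 2 ν) :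
    ∫ x, h x ^ 2 ∂ν = ‖hh.toLp h‖ ^ 2 := by
  rw [← real_inner_self_eq_norm_sq, L2.inner_def]
  refine integral_congr_ae ?_
  filter_upwards [hh.coeFn_toLp] with x hx
  simp [hx, sq]

theorem inner_toLp_eq_integral {h : 𝒳 → ℝ} {ν : Measure 𝒳} (e : Lp ℝ 2 ν) (hh : MemLp h 2 ν) :
    ⟪e, hh.toLp h⟫_ℝ = ∫ x, e x * h x ∂ν := by
  rw [L2.inner_def]
  refine integral_congr_ae ?_
  filter_upwards [hh.coeFn_toLp] with x hx
  simp [hx, mul_comm]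

/-- Parseval's identity for an error in `L²`. -/
theorem ofReal_integral_sq_eq_tsum {ι : Type*} {h : 𝒳 → ℝ} {ν : Measure 𝒳} (hh : MemLp h 2 ν)
    (b : HilbertBasis ι ℝ (Lp ℝ 2 ν)) :
    ENNReal.ofReal (∫ x, h x ^ 2 ∂ν)
      = ∑' i, ENNReal.ofReal ((∫ x, b i x * h x ∂ν) ^ 2) := by
  rw [integral_sq_eq_norm_sq hh, ← tsum_ofReal_inner_sq b]
  simp_rw [inner_toLp_eq_integral]

theorem eLpNorm_sq_eq_ofReal_integral_sq {h : 𝒳 → ℝ} {ν : Measure 𝒳} (hh : MemLp h 2 ν) :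
    eLpNorm h 2 ν ^ 2 = ENNReal.ofReal (∫ x, h x ^ 2 ∂ν) := by
  rw [integral_sq_eq_norm_sq hh, ENNReal.ofReal_pow (norm_nonneg _), Lp.norm_toLp,
    ENNReal.ofReal_toReal hh.eLpNorm_ne_top]

theorem aemeasurable_errorCoord (hφ : Measurable (Function.uncurry φ))
    (hw : ∀ k ∈ Set.Icc 1 T, HasLaw (w k) (ρ.prod μ) P) {t : ℕ} (ht : t ≤ T) {e : 𝒳 → ℝ}
    (he : Measurable e) : AEMeasurable (fun ω => errorCoord ρ φ η e t fun k => w k ω) P := by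
  obtain ⟨z₀⟩ : Nonempty ((𝒳 × ℝ) × V) := (ρ.prod μ).nonempty_of_neZero
  simp_rw [← errorCoord_past z₀]
  exact (measurable_errorCoord hφ he t).comp_aemeasurable
    (aemeasurable_past ht fun k hk => (hw k hk).aemeasurable)

theorem lintegral_ofReal_integral_sq_eq_tsum {ι : Type*} [Countable ι]
    (hφ : Measurable (Function.uncurry φ)) (hb : ∀ᵐ v ∂μ, ∀ᵐ x ∂ρ.fst, |φ v x| ≤ κ)
    (hρ : MemLp (regressionFunction ρ) 2 ρ.fst)
    (hw : ∀ k ∈ Set.Icc 1 T, HasLaw (w k) (ρ.prod μ) P) (b : HilbertBasis ι ℝ (Lp ℝ 2 ρ.fst))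
    {t : ℕ} (ht : t ≤ T) :
    ∫⁻ ω, ENNReal.ofReal (∫ x, (dsIterate η 0 φ (fun k => w k ω) t x
        - regressionFunction ρ x) ^ 2 ∂ρ.fst) ∂P
      = ∑' i, ∫⁻ ω, ENNReal.ofReal ((errorCoord ρ φ η (b i) t fun k => w k ω) ^ 2) ∂P := by
  rw [← lintegral_tsum fun i => ((aemeasurable_errorCoord hφ hw ht
    (Lp.stronglyMeasurable (b i)).measurable).pow_const 2).ennreal_ofReal]
  refine lintegral_congr_ae ?_
  filter_upwards [ae_memLp_dsIterate (η := η) hφ hb hw ht] with ω hω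
  exact ofReal_integral_sq_eq_tsum (hω.sub hρ) b

theorem expectedExcess_eq_tsum {ι : Type*} [Countable ι]
    (hφ : Measurable (Function.uncurry φ)) (hb : ∀ᵐ v ∂μ, ∀ᵐ x ∂ρ.fst, |φ v x| ≤ κ)
    (hρ : MemLp (regressionFunction ρ) 2 ρ.fst)
    (hw : ∀ k ∈ Set.Icc 1 T, HasLaw (w k) (ρ.prod μ) P) (b : HilbertBasis ι ℝ (Lp ℝ 2 ρ.fst))
    {t : ℕ} (ht : t ≤ T) :
    expectedExcess P ρ φ w η 0 t
      = ∑' i, ∫⁻ ω, ENNReal.ofReal ((errorCoord ρ φ η (b i) t fun k => w k ω) ^ 2) ∂P := by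
  rw [← lintegral_ofReal_integral_sq_eq_tsum hφ hb hρ hw b ht]
  refine lintegral_congr_ae ?_
  filter_upwards [ae_memLp_dsIterate (η := η) hφ hb hw ht] with ω hω
  exact eLpNorm_sq_eq_ofReal_integral_sq (hω.sub hρ)

/-- The recursion for the second moment of one coordinate of the error. -/
theorem lintegral_errorCoord_succ_le (hκ : 0 ≤ κ)
    (hy : Integrable (fun z : 𝒳 × ℝ => z.2 ^ 2) ρ) (hφ : Measurable (Function.uncurry φ))
    (hb : ∀ᵐ v ∂μ, ∀ᵐ x ∂ρ.fst, |φ v x| ≤ κ) (hKm : Measurable (Function.uncurry K))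
    (hK : ∀ x x', K x x' = ∫ v, φ v x * φ v x' ∂μ)
    (hρ : MemLp (regressionFunction ρ) 2 ρ.fst) {e : Lp ℝ 2 ρ.fst} {σ S : ℝ}
    (he : integralOperator ρ.fst K e = σ • e)
    (hσ : σ = ∫ v, featureCoeff ρ.fst φ e v ^ 2 ∂μ)
    (hS : expectedRisk ρ (regressionFunction ρ) ≤ S) (hs : IsSample P ρ μ T w)
    {t : ℕ} (ht : t + 1 ≤ T) :
    ∫⁻ ω, ENNReal.ofReal ((errorCoord ρ φ η e (t + 1) fun k => w k ω) ^ 2) ∂P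
      ≤ ENNReal.ofReal ((1 - η (t + 1) * σ) ^ 2) *
          ∫⁻ ω, ENNReal.ofReal ((errorCoord ρ φ η e t fun k => w k ω) ^ 2) ∂P
        + ENNReal.ofReal (κ ^ 2 * η (t + 1) ^ 2 * σ) *
          (∫⁻ ω, ENNReal.ofReal (∫ x, (dsIterate η 0 φ (fun k => w k ω) t x
            - regressionFunction ρ x) ^ 2 ∂ρ.fst) ∂P + ENNReal.ofReal S) := by
  obtain ⟨z₀⟩ : Nonempty ((𝒳 × ℝ) × V) := (ρ.prod μ).nonempty_of_neZero
  have hem : Measurable (e : 𝒳 → ℝ) := (Lp.stronglyMeasurable e).measurable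
  -- The squared coordinate after one step, as a function of the past and the new sample. The padded
  -- past serves because `f_{t+1}` reads only the samples `1, …, t`.
  set F : (ℕ → (𝒳 × ℝ) × V) × ((𝒳 × ℝ) × V) → ℝ≥0∞ := fun q =>
    ENNReal.ofReal ((∫ x, e x * ((dsIterate η 0 φ q.1 t x
      - η (t + 1) * (dsIterate η 0 φ q.1 t q.2.1.1 - q.2.1.2) * φ q.2.2 q.2.1.1 * φ q.2.2 x)
        - regressionFunction ρ x) ∂ρ.fst) ^ 2) with hF
  have hFm : Measurable F := by
    have m0 := measurable_dsIterate hφ η 0 t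
    have m1 : Measurable fun p : ((ℕ → (𝒳 × ℝ) × V) × ((𝒳 × ℝ) × V)) × 𝒳 =>
        dsIterate η 0 φ p.1.1 t p.2 := m0.comp (measurable_fst.fst.prodMk measurable_snd)
    have m2 : Measurable fun p : ((ℕ → (𝒳 × ℝ) × V) × ((𝒳 × ℝ) × V)) × 𝒳 =>
        dsIterate η 0 φ p.1.1 t p.1.2.1.1 :=
      m0.comp (measurable_fst.fst.prodMk measurable_fst.snd.fst.fst)
    have m3 : Measurable fun p : ((ℕ → (𝒳 × ℝ) × V) × ((𝒳 × ℝ) × V)) × 𝒳 =>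
        φ p.1.2.2 p.1.2.1.1 :=
      hφ.comp (measurable_fst.snd.snd.prodMk measurable_fst.snd.fst.fst)
    have m4 : Measurable fun p : ((ℕ → (𝒳 × ℝ) × V) × ((𝒳 × ℝ) × V)) × 𝒳 =>
        φ p.1.2.2 p.2 := hφ.comp (measurable_fst.snd.snd.prodMk measurable_snd)
    have m5 : Measurable fun p : ((ℕ → (𝒳 × ℝ) × V) × ((𝒳 × ℝ) × V)) × 𝒳 => p.1.2.1.2 :=
      measurable_fst.snd.fst.snd
    have m6 := (hem.comp measurable_snd).mul
      ((m1.sub ((((m2.sub m5).const_mul (η (t + 1))).mul m3).mul m4)).sub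
        ((measurable_regressionFunction ρ).comp measurable_snd))
    exact (m6.stronglyMeasurable.integral_prod_right.measurable.pow_const 2).ennreal_ofReal
  calc ∫⁻ ω, ENNReal.ofReal ((errorCoord ρ φ η e (t + 1) fun k => w k ω) ^ 2) ∂P
      = ∫⁻ ω, F (past z₀ w t ω, w (t + 1) ω) ∂P := by
        refine lintegral_congr fun ω => ?_
        simp only [hF, errorCoord]
        rw [dsIterate_congr η 0 fun k h1 h2 => past_of_le h1 h2 ω]
        simp_rw [dsIterate_succ_zero]
    _ = ∫⁻ ω, ∫⁻ z, F (past z₀ w t ω, z) ∂(ρ.prod μ) ∂P :=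
        lintegral_past_prod ht hs.2 hs.1 hFm
    _ ≤ ∫⁻ ω, (ENNReal.ofReal ((1 - η (t + 1) * σ) ^ 2) *
          ENNReal.ofReal ((errorCoord ρ φ η e t fun k => w k ω) ^ 2)
        + ENNReal.ofReal (κ ^ 2 * η (t + 1) ^ 2 * σ) *
          (ENNReal.ofReal (∫ x, (dsIterate η 0 φ (fun k => w k ω) t x
            - regressionFunction ρ x) ^ 2 ∂ρ.fst) + ENNReal.ofReal S)) ∂P := by
        refine lintegral_mono_ae ?_
        filter_upwards [ae_memLp_dsIterate (η := η) hφ hb hs.2 (t := t) (by omega)] with ω hω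
        have h1 := lintegral_coordinate_step_le hκ hy hφ hb hKm hK hρ he hσ hS
          (measurable_dsIterate_apply hφ η 0 (fun k => w k ω) t) hω (η (t + 1))
        refine le_trans (le_of_eq ?_) h1
        simp only [hF]
        rw [dsIterate_congr η 0 fun k h1 h2 => past_of_le h1 h2 ω]
    _ = _ := by
        rw [lintegral_add_left', lintegral_const_mul' _ _ ENNReal.ofReal_ne_top,
          lintegral_const_mul' _ _ ENNReal.ofReal_ne_top, lintegral_add_right _ measurable_const,
          lintegral_const, measure_univ, mul_one]
        exact ((aemeasurable_errorCoord hφ hs.2 (by omega) hem).pow_const 2).ennreal_ofReal.const_mul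
          _

end Excess

/-- The learning rate of the unregularized algorithm with step sizes `η₁ t ^ (-θ)`. -/
theorem exists_expectedExcess_rate {κ c γ ζ R S θ η₁ : ℝ} (hκ : 0 ≤ κ) (hc : 0 ≤ c)
    (hγ0 : 0 ≤ γ) (hγ1 : γ ≤ 1) (hζ : 0 < ζ) (hθ0 : 0 ≤ θ) (hθ : θ ≤ 1 / 2)
    (hη : 0 < η₁) (hηκ : η₁ * κ ^ 2 ≤ 1) (hα : 0 < θ * (1 + γ) - γ) :
    ∃ C : ℝ, 0 < C ∧ ∀ (𝒳 : Type*) [MeasurableSpace 𝒳] [MeasurableSpace.CountablyGenerated 𝒳]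
      (ρ : Measure (𝒳 × ℝ)) [IsProbabilityMeasure ρ] (V : Type*) [MeasurableSpace V]
      (μ : Measure V) [IsProbabilityMeasure μ] (φ : V → 𝒳 → ℝ) (K : 𝒳 → 𝒳 → ℝ),
      IsFeatureModel ρ μ φ K → Bounded ρ μ φ K κ → Regular ρ K ζ R → Capacity ρ K γ c →
      expectedRisk ρ (regressionFunction ρ) ≤ S →
      ∀ (Ω : Type*) [MeasurableSpace Ω] (P : Measure Ω) [IsProbabilityMeasure P]
        (T : ℕ) (w : ℕ → Ω → (𝒳 × ℝ) × V), IsSample P ρ μ T w →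
      ∀ t : ℕ, 2 ≤ t → t ≤ T → expectedExcess P ρ φ w (stepSize η₁ θ) 0 t ≤ ENNReal.ofReal
        (C * (((t : ℝ) ^ (-(2 * ζ * (1 - θ))) + (t : ℝ) ^ (-(θ * (1 + γ) - γ))) *
          Real.log t)) := by
  obtain ⟨C, hC, hrate⟩ := exists_rate_of_recursion (R := R) (S := max S 0) hc hγ0 hγ1 hζ
    (le_max_right S 0) hθ0 hθ hη hηκ hα
  refine ⟨C, hC, ?_⟩
  intro 𝒳 _ _ ρ _ V _ μ _ φ K hmodel hbdd hreg hcap hS Ω _ P _ T w hs t ht2 htT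
  have hφ := hmodel.measurable_feature
  have hK := hmodel.kernel_eq
  have hKm := hbdd.measurable_kernel
  have hb : ∀ᵐ v ∂μ, ∀ᵐ x ∂ρ.fst, |φ v x| ≤ κ := by
    filter_upwards [Measure.ae_ae_of_ae_prod hbdd.feature_le] with v hv
    exact ae_abs_le_of_ae_mul_le hκ hv
  obtain ⟨g, hgR, hg⟩ := hreg
  have hρ : MemLp (regressionFunction ρ) 2 ρ.fst := (Lp.memLp _).ae_eq hg
  have hsymm := isSymmetric_integralOperator hκ hφ hb hKm hK
  obtain ⟨J, b, σ, hLb, hσ, hσ0, hσκ⟩ := exists_eigenbasis_integralOperator hκ hφ hb hKm hK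
  -- With the countably generated σ-algebra this makes `L²(ρ_X)` separable, so the eigenbasis is
  -- countable.
  have hne : Fact ((2 : ℝ≥0∞) ≠ ∞) := ⟨ENNReal.ofNat_ne_top⟩
  have hJ : Countable J := countable_of_hilbertBasis b
  rw [expectedExcess_eq_tsum hφ hb hρ hs.2 b htT]
  refine hrate σ (fun i => ⟪b i, g⟫_ℝ)
    (fun t i => ∫⁻ ω, ENNReal.ofReal
      ((errorCoord ρ φ (stepSize η₁ θ) (b i) t fun k => w k ω) ^ 2) ∂P)
    T hσ0 hσκ ?_ ?_ ?_ ?_ t ht2 htT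
  · intro lam hlam
    refine le_trans (le_of_eq ?_) (hcap lam hlam)
    refine (posTrace_mul_inverse _ (fun x => ?_) b hLb hσ0 hlam).symm
    rw [real_inner_comm, inner_integralOperator hκ hφ hb hKm hK]
    exact integral_nonneg fun v => mul_self_nonneg _
  · intro i
    -- Since `f_1 = 0`, the initial error is `-f_ρ = -L_K^ζ g`; here regularity enters the
    -- recursion.
    have h1 : errorCoord ρ φ (stepSize η₁ θ) (b i) 0 = fun _ =>
        -⟪b i, opRpow (integralOperator ρ.fst K) ζ g⟫_ℝ := by
      funext W
      simp only [errorCoord, dsIterate, L2.inner_def]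
      rw [← integral_neg]
      refine integral_congr_ae ?_
      filter_upwards [hg] with x hx
      simp [hx, mul_comm]
    simp only [h1, neg_sq, lintegral_const, measure_univ, mul_one]
    refine ENNReal.ofReal_le_ofReal ((sq_inner_opRpow_le _ hsymm (hLb i) g).trans (le_of_eq ?_))
    rw [mul_pow, ← Real.rpow_natCast, ← Real.rpow_mul (hσ0 i)]
    push_cast
    rw [mul_comm ζ]
  · rw [tsum_ofReal_inner_sq b g]
    refine ENNReal.ofReal_le_ofReal ?_
    gcongr
  · intro s hsT i
    have h1 := lintegral_errorCoord_succ_le (η := stepSize η₁ θ) hκ hmodel.integrable_sq hφ hb hKm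
      hK hρ (hLb i) (hσ i) (hS.trans (le_max_left S 0)) hs hsT
    rwa [lintegral_ofReal_integral_sq_eq_tsum hφ hb hρ hs.2 b (by omega)] at h1

end DoublyStochastic

/-! ### The two step-size regimes -/

theorem mainTheorem6 (κ c γ ζ R M S : ℝ) (hκ : 1 ≤ κ) (hc : 0 < c)
    (hγ0 : 0 ≤ γ) (hγ1 : γ ≤ 1) (hγne : γ ≠ 1) (hζ : 0 < ζ) (hR : 0 < R) :
    ∃ C : ℝ, 0 < C ∧
      ∀ (d : ℕ) (X : Set (EuclideanSpace ℝ (Fin d))), IsClosed X →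
      ∀ (ρ : MeasureTheory.Measure (X × ℝ)) [MeasureTheory.IsProbabilityMeasure ρ]
        (V : Type*) [MeasurableSpace V]
        (μ : MeasureTheory.Measure V) [MeasureTheory.IsProbabilityMeasure μ]
        (φ : V → X → ℝ) (K : X → X → ℝ),
      DoublyStochastic.IsFeatureModel ρ μ φ K →
      DoublyStochastic.Bounded ρ μ φ K κ →
      DoublyStochastic.Regular ρ K ζ R →
      DoublyStochastic.Capacity ρ K γ c →
      MeasureTheory.eLpNorm (DoublyStochastic.regressionFunction ρ) 2 ρ.fst ≤ ENNReal.ofReal M →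
      DoublyStochastic.expectedRisk ρ (DoublyStochastic.regressionFunction ρ) ≤ S →
      ∀ (Ω : Type*) [MeasurableSpace Ω]
        (P : MeasureTheory.Measure Ω) [MeasureTheory.IsProbabilityMeasure P]
        (T : ℕ) (w : ℕ → Ω → (X × ℝ) × V),
      DoublyStochastic.IsSample P ρ μ T w →
      ∀ t : ℕ, 2 ≤ t → t ≤ T →
        (2 * ζ < 1 - γ →
          DoublyStochastic.expectedExcess P ρ φ w
              (fun k => ζ / (3 * κ ^ 2 * (2 * c + κ ^ 2)) *
                (k : ℝ) ^ (-((2 * ζ + γ) / (2 * ζ + γ + 1)))) 0 t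
            ≤ ENNReal.ofReal (C * ((t : ℝ) ^ (-(2 * ζ / (2 * ζ + γ + 1))) * Real.log t))) ∧
        (1 - γ ≤ 2 * ζ →
          DoublyStochastic.expectedExcess P ρ φ w
              (fun k => (1 - γ) / (6 * κ ^ 2 * (2 * c + κ ^ 2)) *
                (k : ℝ) ^ (-(1 / 2 : ℝ))) 0 t
            ≤ ENNReal.ofReal (C * ((t : ℝ) ^ ((γ - 1) / 2) * Real.log t))) := by
  have hκ0 : 0 < κ := by linarith
  have hκ2 : 1 ≤ κ ^ 2 := one_le_pow₀ hκ
  have hγlt : 0 < 1 - γ := sub_pos.mpr (lt_of_le_of_ne hγ1 hγne)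
  -- The case depends only on the parameters, so it may be decided before `C` is chosen; the other
  -- half of the conclusion is then vacuous.
  rcases lt_or_ge (2 * ζ) (1 - γ) with hcase | hcase
  · have hden : 0 < 2 * ζ + γ + 1 := by linarith
    -- This `θ` solves `θ(1+γ) - γ = 2ζ(1-θ)`, equalizing variance and bias; `θ ≤ 1/2` amounts to
    -- `2ζ + γ ≤ 1`.
    have hα : (2 * ζ + γ) / (2 * ζ + γ + 1) * (1 + γ) - γ = 2 * ζ / (2 * ζ + γ + 1) := by
      field_simp
      ring
    have hβ : 2 * ζ * (1 - (2 * ζ + γ) / (2 * ζ + γ + 1)) = 2 * ζ / (2 * ζ + γ + 1) := by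
      field_simp
      ring
    obtain ⟨C, hC, h⟩ := DoublyStochastic.exists_expectedExcess_rate (R := R) (S := S)
      (θ := (2 * ζ + γ) / (2 * ζ + γ + 1)) (η₁ := ζ / (3 * κ ^ 2 * (2 * c + κ ^ 2)))
      hκ0.le hc.le hγ0 hγ1 hζ (by positivity)
      (by rw [div_le_div_iff₀ hden two_pos]; linarith) (by positivity)
      (by
        rw [div_mul_eq_mul_div, div_le_one (by positivity)]
        nlinarith [mul_pos (sq_pos_of_pos hκ0) hc])
      (by rw [hα]; positivity)
    rw [hα, hβ] at h
    refine ⟨2 * C, by positivity, ?_⟩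
    intro d X _ ρ _ V _ μ _ φ K h1 h2 h3 h4 _ h5 Ω _ P _ T w hs t ht htT
    refine ⟨fun _ => ?_, fun hcase' => absurd hcase (not_lt.mpr hcase')⟩
    refine (h X ρ V μ φ K h1 h2 h3 h4 h5 Ω P T w hs t ht htT).trans
      (ENNReal.ofReal_le_ofReal (le_of_eq ?_))
    ring
  · obtain ⟨C, hC, h⟩ := DoublyStochastic.exists_expectedExcess_rate (R := R) (S := S)
      (θ := 1 / 2) (η₁ := (1 - γ) / (6 * κ ^ 2 * (2 * c + κ ^ 2)))
      hκ0.le hc.le hγ0 hγ1 hζ (by norm_num) le_rfl (by positivity)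
      (by
        rw [div_mul_eq_mul_div, div_le_one (by positivity)]
        nlinarith [mul_pos (sq_pos_of_pos hκ0) hc])
      -- At `θ = 1/2` the variance exponent is `(1-γ)/2`, positive exactly because `γ < 1`.
      (by linarith)
    refine ⟨2 * C, by positivity, ?_⟩
    intro d X _ ρ _ V _ μ _ φ K h1 h2 h3 h4 _ h5 Ω _ P _ T w hs t ht htT
    refine ⟨fun hcase' => absurd hcase' (not_lt.mpr hcase), fun _ => ?_⟩
    refine (h X ρ V μ φ K h1 h2 h3 h4 h5 Ω P T w hs t ht htT).trans
      (ENNReal.ofReal_le_ofReal ?_)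
    have ht1 : (1 : ℝ) ≤ t := by exact_mod_cast (by omega : 1 ≤ t)
    -- The bias exponent is `ζ ≥ (1-γ)/2`, so the variance dominates.
    have e1 : (t : ℝ) ^ (-(2 * ζ * (1 - 1 / 2))) ≤ (t : ℝ) ^ ((γ - 1) / 2) :=
      Real.rpow_le_rpow_of_exponent_le ht1 (by linarith)
    have e2 : (t : ℝ) ^ (-(1 / 2 * (1 + γ) - γ)) = (t : ℝ) ^ ((γ - 1) / 2) := by
      congr 1
      ring
    rw [e2]
    have hlog : 0 ≤ Real.log t := Real.log_nonneg ht1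
    calc _ ≤ C * (((t : ℝ) ^ ((γ - 1) / 2) + (t : ℝ) ^ ((γ - 1) / 2)) * Real.log t) := by gcongr
      _ = _ := by ring
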